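/- \textbf{Setting.} Let $d\ge 1$, $b\ge 2$, $s\ge 0$ be integers. For $j\in\{1,\dots,s\}$ let $\mathcal X^{(j)}\subset\mathbb R^d$ be bounded with volume $1$, and let $\mathcal X=\prod_{j=1}^s\mathcal X^{(j)}\subset\mathbb R^{ds}$. Let each $\mathcal X^{(j)}$ have a recursive split in base $b$: cells $\mathcal X_{j,(k,t)}$ for $k\ge0$, $0\le t<b^k$, with $\mathcal X_{j,(0,0)}=\mathcal X^{(j)}$, such that $\mathcal X_{j,(k,t)}$ is the union of the Borel sets $\mathcal X_{j,(k,t,c)}:=\mathcal X_{j,(k+1,bt+c)}$, $0\le c<b$, each of volume $\mathrm{vol}(\mathcal X_{j,(k,t)})/b$, with pairwise intersections of volume $0$. Suppose that for some $1\le C<\infty$ all cells $\mathcal X_{j,(k,t)}$ have Euclidean diameter at most $Cb^{-k/d}$. For $u\subseteq\{1,\dots,s\}$ let $f_u$ be the ANOVA component of $f:\mathcal X\to\mathbb R$, defined recursively by $f_u(x)=\int_{\mathcal X^{-u}}\bigl(f(x)-\sum_{v\subsetneq u}f_v(x)\bigr)\,dx_{-u}$, where $\mathcal X^{-u}=\prod_{j\notin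 u}\mathcal X^{(j)}$. For tuples $\kappa=(k_j)_{j\in u}$, $\tau=(t_j)_{j\in u}$, $\gamma=(c_j)_{j\in u}$ with $k_j\ge0$, $0\le t_j<b^{k_j}$, $0\le c_j<b$ put $|\kappa|=\sum_{j\in u}k_j$ and $$\psi_{u\kappa\tau\gamma}(x)=\prod_{j\in u}\Bigl(b^{(k_j+1)/2}1_{x_j\in\mathcal X_{j,(k_j,t_j,c_j)}}-b^{(k_j-1)/2}1_{x_j\in\mathcal X_{j,(k_j,t_j)}}\Bigr),\qquad x\in\mathcal X,$$ and $\langle f,g\rangle=\int_{\mathcal X}fg\,dx$. Write $\mathrm{rect}(A)$ for the smallest closed axis-parallel box containing the bounded set $A$, $\mathbb B_{u\kappa\tau}=\prod_{j\in u}\mathcal X_{j,(k_j,t_j)}\prod_{j\notin u}\mathcal X^{(j)}$, and $\widetilde{\mathbb B}_{u\kappa\tau}=\mathrm{rect}(\mathbb B_{u\kappa\tau})$. Let $S_j\subset\{1,\dots,ds\}$ be the set of the $d$ coordinates of the $j$-th factor, $S_u=\bigcup_{j\in u}S_j$, and $\mathbb S_u=\{v\subseteq S_u: v\cap S_j\neq\emptyset\text{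 for all }j\in u\}$. For a set $v$ of coordinates, $\partial^v$ differentiates once with respect to each coordinate in $v$; derivatives of a function on a set are taken within that set, and derivatives of extensions (on $\mathrm{rect}(\mathcal X)$) are taken to be $0$ where they do not exist. Suprema are taken in $[0,\infty]$. \textbf{Statement.} For all $u,\kappa,\tau,\gamma$ as above, the bound $$|\langle f,\psi_{u\kappa\tau\gamma}\rangle|\le\Bigl(2-\frac2b\Bigr)^{|u|}b^{-\frac{|\kappa|}2(1+\frac2d)-\frac{|u|}2}\sum_{v\in\mathbb S_u}d^{|v|/2}C^{|v|}\sup_{y\in\widetilde{\mathbb B}_{u\kappa\tau}}|\partial^v\tilde f_u(y)|\qquad(*)$$ holds in each of the following two cases. (i) $\mathcal X$ is closed with non-empty interior and is Sobol' extensible with some anchor $c\in\mathcal X$, that is, $\mathrm{rect}(\{c,z\})\subseteq\mathcal X$ for all $z\in\mathcal X$; $f$ is smooth on $\mathcal X$, that is, all $\partial^vf$, $v\subseteq\{1,\dots,ds\}$, exist and are continuous on $\mathcal X$; and $\tilde f_u$ is the Sobol' extension of $f_u$, $$\tilde f_u(x)=\sum_{w\subseteq\{1,\dots,ds\}}\int_{[c_w,x_w]}\partial^wf_u(c_{-w}{:}y_w)\,1_{c_{-w}:y_w\in\mathcal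 X}\,dy_w ,$$ where $c_{-w}{:}y_w$ has the coordinates of $y$ in $w$ and those of $c$ outside $w$, and $\int_{[c_w,x_w]}$ is the integral over the box spanned by $c_w$ and $x_w$, with a minus sign if $c_l>x_l$ for an odd number of $l\in w$. (ii) Each $\mathcal X^{(j)}$ is closed with non-empty interior and a boundary of measure zero; $f\in C^{ds}(\mathcal X)$, that is, all partial derivatives of $f$ of total order at most $ds$ exist and are continuous on $\mathcal X$; and $\tilde f_u$ is any Whitney extension of $f_u$, that is, any $\tilde f_u\in C^{ds}(\mathrm{rect}(\mathcal X))$ whose partial derivatives of total order at most $ds$ (including order $0$) agree with those of $f_u$ on $\mathcal X$ and which is analytic on $\mathrm{rect}(\mathcal X)\setminus\mathcal X$. Here $\mathcal X$ need not be Sobol' extensible. -/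

import Mathlib

open MeasureTheory Set
open scoped ENNReal Topology

noncomputable section

/-! ### Splits -/

/-- A `b`-fold split of `A ⊆ ℝ^d` into the Borel sets `P a`, `a ∈ ℤ_b`. -/
structure IsSplit {d : ℕ} (b : ℕ) (A : Set (EuclideanSpace ℝ (Fin d)))
    (P : Fin b → Set (EuclideanSpace ℝ (Fin d))) : Prop where
  borel : ∀ a, MeasurableSet (P a)
  union : A = ⋃ a, P a
  volume_eq : ∀ a, volume (P a) = volume A / (b : ℝ≥0∞)
  overlap : ∀ a a', a ≠ a' → volume (P a ∩ P a') = 0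

/-- A recursive `b`-fold split of `A`.  The cells at level `k` are `cell k t` for `0 ≤ t < b ^ k`;
`cell k t` is split into the cells `cell (k + 1) (b * t + c)`, `c ∈ ℤ_b`. -/
structure RecursiveSplit {d : ℕ} (b : ℕ) (A : Set (EuclideanSpace ℝ (Fin d))) where
  cell : ℕ → ℕ → Set (EuclideanSpace ℝ (Fin d))
  cell_zero : cell 0 0 = A
  isSplit : ∀ k t, t < b ^ k →
    IsSplit b (cell k t) (fun c : Fin b => cell (k + 1) (b * t + (c : ℕ)))

/-! ### Products of regions

A point of `(ℝ^d)^J` is a function `J × Fin d → ℝ`; the coordinate `(j, i)` is the `i`-th coordinate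
of the `j`-th component. -/

/-- The component `x_j ∈ ℝ^d` of `x`. -/
def component {J : Type*} {d : ℕ} (x : J × Fin d → ℝ) (j : J) : EuclideanSpace ℝ (Fin d) :=
  WithLp.toLp 2 (fun i => x (j, i))

/-- The Cartesian product of the sets `X j`, `j ∈ J`. -/
def prodSet {J : Type*} {d : ℕ} (X : J → Set (EuclideanSpace ℝ (Fin d))) : Set (J × Fin d → ℝ) :=
  {x | ∀ j, component x j ∈ X j}

/-- The rectangular hull (bounding box) of a set. -/
def rectHull {ι : Type*} (A : Set (ι → ℝ)) : Set (ι → ℝ) :=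
  {y | ∀ l, y l ∈ Icc (sInf ((fun x : ι → ℝ => x l) '' A)) (sSup ((fun x : ι → ℝ => x l) '' A))}

/-! ### ANOVA -/

/-- The point whose components are those of `x` for `j ∈ u` and those of `y` for `j ∉ u`. -/
def glue {s d : ℕ} (u : Finset (Fin s)) (x : Fin s × Fin d → ℝ)
    (y : {j : Fin s // j ∉ u} × Fin d → ℝ) : Fin s × Fin d → ℝ :=
  fun p => if h : p.1 ∈ u then x p else y (⟨p.1, h⟩, p.2)

/-- `∫_{X^{-u}} g(x) dx_{-u}`, as a function of `x` (it depends on `x_u` only). -/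
def integralOut {s d : ℕ} (X : Fin s → Set (EuclideanSpace ℝ (Fin d))) (u : Finset (Fin s))
    (g : (Fin s × Fin d → ℝ) → ℝ) (x : Fin s × Fin d → ℝ) : ℝ :=
  ∫ y in prodSet (fun j : {j : Fin s // j ∉ u} => X j.1), g (glue u x y)

/-- The ANOVA component `f_u = ∫_{X^{-u}} (f - ∑_{v ⊊ u} f_v) dx_{-u}`. -/
def anova {s d : ℕ} (X : Fin s → Set (EuclideanSpace ℝ (Fin d)))
    (f : (Fin s × Fin d → ℝ) → ℝ) (u : Finset (Fin s)) : (Fin s × Fin d → ℝ) → ℝ :=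
  integralOut X u (fun x => f x - ∑ v ∈ u.ssubsets.attach, anova X f v.1 x)
termination_by u.card
decreasing_by exact Finset.card_lt_card (Finset.mem_ssubsets.1 v.2)

/-! ### Multiresolution -/

/-- The univariate basis function
`ψ_{ktc} = b^{(k+1)/2} 1_{X_{(k,t,c)}} - b^{(k-1)/2} 1_{X_{(k,t)}}`. -/
def haar {d b : ℕ} {A : Set (EuclideanSpace ℝ (Fin d))} (S : RecursiveSplit b A) (k t c : ℕ)
    (x : EuclideanSpace ℝ (Fin d)) : ℝ :=
  (b : ℝ) ^ (((k : ℝ) + 1) / 2) * (S.cell (k + 1) (b * t + c)).indicator 1 x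
    - (b : ℝ) ^ (((k : ℝ) - 1) / 2) * (S.cell k t).indicator 1 x

/-- The basis function `ψ_{uκτγ}(x) = ∏_{j ∈ u} ψ_{j k_j t_j c_j}(x_j) ∏_{j ∉ u} φ_j(x_j)`, where
`φ_j = 1` on `X j`. -/
def multiHaar {s d b : ℕ} {X : Fin s → Set (EuclideanSpace ℝ (Fin d))}
    (S : ∀ j, RecursiveSplit b (X j)) (u : Finset (Fin s)) (κ : u → ℕ)
    (τ : ∀ j : u, Fin (b ^ κ j)) (γ : u → Fin b) (x : Fin s × Fin d → ℝ) : ℝ :=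
  (∏ j : u, haar (S j.1) (κ j) (τ j) (γ j) (component x j.1)) *
    ∏ j ∈ uᶜ, (X j).indicator 1 (component x j)

/-- The inner product `⟨f, g⟩` of `L²` of the product of the sets `X j`. -/
def innerProd {s d : ℕ} (X : Fin s → Set (EuclideanSpace ℝ (Fin d)))
    (f g : (Fin s × Fin d → ℝ) → ℝ) : ℝ :=
  ∫ x in prodSet X, f x * g x

/-- `B_{uκτ} = ∏_{j ∈ u} X_{j,(k_j,t_j)} ∏_{j ∉ u} X^{(j)}`. -/
def cellProd {s d b : ℕ} {X : Fin s → Set (EuclideanSpace ℝ (Fin d))}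
    (S : ∀ j, RecursiveSplit b (X j)) (u : Finset (Fin s)) (κ : u → ℕ)
    (τ : ∀ j : u, Fin (b ^ κ j)) : Set (Fin s × Fin d → ℝ) :=
  prodSet (fun j => if h : j ∈ u then (S j).cell (κ ⟨j, h⟩) (τ ⟨j, h⟩) else X j)

/-! ### Partial derivatives -/

/-- The values of the coordinate `l` for which the point `x`, with its other coordinates kept,
is in `D`. -/
def slice {ι : Type*} [DecidableEq ι] (D : Set (ι → ℝ)) (x : ι → ℝ) (l : ι) : Set ℝ :=
  {r | Function.update x l r ∈ D}

/-- `h x a` : `a` is the partial derivative at `x`, with respect to the coordinate `l`, of the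
function `g` on `D` (one-sided where `D` lies on one side only). -/
def HasPartialWithinAt {ι : Type*} [DecidableEq ι] (D : Set (ι → ℝ)) (g : (ι → ℝ) → ℝ) (l : ι)
    (x : ι → ℝ) (a : ℝ) : Prop :=
  HasDerivWithinAt (fun r => g (Function.update x l r)) a (slice D x l) (x l)

/-- The partial derivative of the function `g` on `D`, and `0` where it does not exist. -/
def partialWithin {ι : Type*} [DecidableEq ι] (D : Set (ι → ℝ)) (l : ι) (g : (ι → ℝ) → ℝ)
    (x : ι → ℝ) : ℝ :=
  derivWithin (fun r => g (Function.update x l r)) (slice D x l) (x l)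

/-- The mixed partial derivative `∂^v g` of the function `g` on `D`, once with respect to each
coordinate in `v`; partial derivatives are `0` where they do not exist. -/
def mixedPartial {s d : ℕ} (D : Set (Fin s × Fin d → ℝ)) (g : (Fin s × Fin d → ℝ) → ℝ)
    (v : Finset (Fin s × Fin d)) : (Fin s × Fin d → ℝ) → ℝ :=
  ((List.finRange s ×ˢ List.finRange d).filter (· ∈ v)).foldr (fun l h => partialWithin D l h) g

/-- `g` is smooth on `D`: the mixed partial derivatives `∂^v g = F v`, for all sets `v` of
coordinates, exist and are continuous on `D`. -/
def SmoothOn {ι : Type*} [DecidableEq ι] (D : Set (ι → ℝ)) (g : (ι → ℝ) → ℝ) : Prop :=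
  ∃ F : Finset ι → (ι → ℝ) → ℝ, EqOn (F ∅) g D ∧ (∀ v, ContinuousOn (F v) D) ∧
    ∀ v, ∀ l ∉ v, ∀ x ∈ D, HasPartialWithinAt D (F v) l x (F (insert l v) x)

/-- The functions `G k`, `|k| ≤ m`, are the partial derivatives `D_k g` of `g` on `D` up to total
order `m`, and they are continuous on `D`. -/
def HasPartialsUpTo {ι : Type*} [Fintype ι] [DecidableEq ι] (D : Set (ι → ℝ)) (m : ℕ)
    (g : (ι → ℝ) → ℝ) (G : (ι → ℕ) → (ι → ℝ) → ℝ) : Prop :=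
  EqOn (G 0) g D ∧ (∀ k, ∑ i, k i ≤ m → ContinuousOn (G k) D) ∧
    ∀ k l, ∑ i, k i < m → ∀ x ∈ D, HasPartialWithinAt D (G k) l x (G (k + Pi.single l 1) x)

/-- `g ∈ C^m(D)`. -/
def InCm {ι : Type*} [Fintype ι] [DecidableEq ι] (D : Set (ι → ℝ)) (m : ℕ)
    (g : (ι → ℝ) → ℝ) : Prop :=
  ∃ G, HasPartialsUpTo D m g G

/-! ### Extensions -/

/-- The closed set `D`, with non-empty interior, is Sobol' extensible with anchor `c`.  Here
`uIcc c z` is the closed box spanned by `c` and `z`. -/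
structure IsSobolExtensible {ι : Type*} (D : Set (ι → ℝ)) (c : ι → ℝ) : Prop where
  isClosed : IsClosed D
  interior_nonempty : (interior D).Nonempty
  anchor_mem : c ∈ D
  box_subset : ∀ z ∈ D, uIcc c z ⊆ D

/-- The hybrid point `c_{-w} : y_w`. -/
def hybrid {ι : Type*} [DecidableEq ι] (c : ι → ℝ) (w : Finset ι) (y : w → ℝ) : ι → ℝ :=
  fun l => if h : l ∈ w then y ⟨l, h⟩ else c l

/-- `∫_{[c_w, x_w]} h(y_w) dy_w`: the integral over the box spanned by `c_w` and `x_w`, with a minus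
sign if `c_l > x_l` for an odd number of `l ∈ w`. -/
def signedBoxIntegral {ι : Type*} (w : Finset ι) (c x : ι → ℝ) (h : (w → ℝ) → ℝ) : ℝ :=
  (∏ l ∈ w, if x l < c l then (-1 : ℝ) else 1) *
    ∫ y in uIcc (fun l : w => c l.1) (fun l : w => x l.1), h y

/-- The Sobol' extension
`g̃(x) = ∑_w ∫_{[c_w, x_w]} ∂^w g(c_{-w} : y_w) 1_{c_{-w} : y_w ∈ D} dy_w`. -/
def sobolExtension {s d : ℕ} (D : Set (Fin s × Fin d → ℝ)) (c : Fin s × Fin d → ℝ)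
    (g : (Fin s × Fin d → ℝ) → ℝ) (x : Fin s × Fin d → ℝ) : ℝ :=
  ∑ w : Finset (Fin s × Fin d),
    signedBoxIntegral w c x (fun y => D.indicator (mixedPartial D g w) (hybrid c w y))

/-- `e` is a Whitney extension of `g ∈ C^m(D)`: it is in `C^m(rect(D))`, it has the same partial
derivatives as `g` on `D` up to total order `m` (including order `0`, so that `e = g` on `D`), and
it is analytic on `rect(D) \ D`. -/
def IsWhitneyExtension {ι : Type*} [Fintype ι] [DecidableEq ι] (D : Set (ι → ℝ)) (m : ℕ)
    (g e : (ι → ℝ) → ℝ) : Prop :=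
  (∃ G E, HasPartialsUpTo D m g G ∧ HasPartialsUpTo (rectHull D) m e E ∧
    ∀ k, ∑ i, k i ≤ m → EqOn (E k) (G k) D) ∧
  AnalyticOn ℝ e (rectHull D \ D)

/-! ### The bound -/

/-- The sets `T ⊆ S_u` of coordinates that meet `S_j` for every `j ∈ u`, where `S_j` is the set of
the coordinates of the `j`-th component and `S_u` is the union of the `S_j`, `j ∈ u`. -/
def touching {s : ℕ} (d : ℕ) (u : Finset (Fin s)) : Finset (Finset (Fin s × Fin d)) :=
  (u ×ˢ Finset.univ).powerset.filter
    (fun T => ∀ j ∈ u, (T ∩ ({j} ×ˢ Finset.univ)).Nonempty)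

/-- The right-hand side
`(2 - 2/b)^{|u|} b^{-(|κ|/2)(1 + 2/d) - |u|/2} ∑_v d^{|v|/2} C^{|v|} sup_{rect(B_{uκτ})} |∂^v e|`
for a function `e` on `rect(X^{1:s})`; the sum is over the `v` in `touching d u` and the suprema are
taken in `[0, ∞]`. -/
def coefficientBound {s d b : ℕ} {X : Fin s → Set (EuclideanSpace ℝ (Fin d))}
    (S : ∀ j, RecursiveSplit b (X j)) (C : ℝ) (u : Finset (Fin s)) (κ : u → ℕ)
    (τ : ∀ j : u, Fin (b ^ κ j)) (e : (Fin s × Fin d → ℝ) → ℝ) : ℝ≥0∞ :=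
  ENNReal.ofReal ((2 - 2 / (b : ℝ)) ^ u.card *
      (b : ℝ) ^ (-(((∑ j, κ j : ℕ) : ℝ) / 2 * (1 + 2 / (d : ℝ))) - (u.card : ℝ) / 2)) *
    ∑ v ∈ touching d u, ENNReal.ofReal ((d : ℝ) ^ ((v.card : ℝ) / 2) * C ^ v.card) *
      ⨆ y ∈ rectHull (cellProd S u κ τ),
        ENNReal.ofReal |mixedPartial (rectHull (prodSet X)) e v y|

end

/-!
The lower ANOVA components are orthogonal to the multivariate Haar function `ψ`, and `f_u`
agrees on `X` with its extension `e`, so `⟨f, ψ⟩ = ⟨f_u, ψ⟩ = ⟨e, ψ⟩`. Since `ψ` has mean zero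
in each block of coordinates `j ∈ u`, this does not change if `e` is replaced by its
alternating difference `∑_{v ⊆ u} (-1)^|u - v| e(z_{-v} : x_v)` at a fixed point `z` of the
cell. Moving the coordinates of each block one at a time writes this difference as a sum, over
the sets `v` with exactly one coordinate in each block of `u`, of mixed differences in the
single coordinates `v`; each of them is at most `sup |∂^v e|` times the product of the edge
lengths. Multiplying by the `L¹`-norm of `ψ` gives the bound, even with the sum restricted to
these `v`.

The extension need not be differentiable everywhere: `∂^v e` is only assumed to exist weakly,
in the sense that `e` belongs to a family of bounded functions `G_P` that satisfy the
fundamental theorem of calculus in each coordinate `l ∉ P`. By Lebesgue's differentiation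
theorem the iterated derivatives of `e` then coincide with `G_v` almost everywhere on suitable
sections, which is enough to estimate the differences by the pointwise supremum of `|∂^v e|`.
Both extensions have such a family: for a Whitney extension it consists of the classical
derivatives, and for the Sobol' extension of the partial sums
`∑_w ∫_{[c_w, x_w]} ∂^{w ∪ P} f_u(c_{-(w ∪ P)} : y_w : x_P) dy_w`.
-/

/-! ### Lebesgue differentiation, uniformly in a parameter -/

theorem enorm_intervalIntegral_le_of_enorm_le {E : Type*} [NormedAddCommGroup E] [NormedSpace ℝ E]
    {p q : ℝ} {M : ℝ≥0∞} {h : ℝ → E} (hM : ∀ᵐ r, r ∈ uIoc p q → ‖h r‖ₑ ≤ M) :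
    ‖∫ r in p..q, h r‖ₑ ≤ M * ‖q - p‖ₑ := by
  rw [← ofReal_norm, intervalIntegral.norm_intervalIntegral_eq, ofReal_norm]
  calc ‖∫ r in uIoc p q, h r‖ₑ ≤ ∫⁻ r in uIoc p q, ‖h r‖ₑ := enorm_integral_le_lintegral_enorm _
    _ ≤ ∫⁻ _ in uIoc p q, M :=
      lintegral_mono_ae ((ae_restrict_iff' measurableSet_uIoc).2 hM)
    _ = M * ‖q - p‖ₑ := by
      rw [setLIntegral_const, Real.volume_uIoc, Real.enorm_eq_ofReal_abs]

theorem ae_forall_hasDerivAt_integral {K E : Type*} [TopologicalSpace K]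
    [TopologicalSpace.SeparableSpace K] [NormedAddCommGroup E] [NormedSpace ℝ E]
    [CompleteSpace E] {φ : K → ℝ → E} (hφ : ∀ k, LocallyIntegrable (φ k))
    (hcont : ∀ k, TendstoUniformly φ (φ k) (𝓝 k)) :
    ∀ᵐ r, ∀ k c, HasDerivAt (fun t => ∫ x in c..t, φ k x) (φ k r) r := by
  obtain ⟨Q, hQ, hQdense⟩ := TopologicalSpace.exists_countable_dense K
  have hint : ∀ k a b, IntervalIntegrable (φ k) volume a b := fun k a b =>
    ((hφ k).integrableOn_isCompact isCompact_uIcc).intervalIntegrable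
  have hderivQ : ∀ᵐ r, ∀ k ∈ Q, ∀ c, HasDerivAt (fun t => ∫ x in c..t, φ k x) (φ k r) r :=
    (ae_ball_iff hQ).2 fun k _ => LocallyIntegrable.ae_hasDerivAt_integral (hφ k)
  filter_upwards [hderivQ] with r hr k c
  rw [hasDerivAt_iff_isLittleO, Asymptotics.isLittleO_iff]
  intro ε hε
  have hnear := Metric.tendstoUniformly_iff.1 (hcont k) (ε / 3) (by positivity)
  obtain ⟨k', hclose, hk'⟩ := mem_closure_iff_nhds.1 (hQdense k) _ hnear
  have hlittle := Asymptotics.isLittleO_iff.1 (hasDerivAt_iff_isLittleO.1 (hr k' hk' c))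
  filter_upwards [hlittle (show 0 < ε / 3 by positivity)] with t ht
  rw [intervalIntegral.integral_interval_sub_left (hint _ _ _) (hint _ _ _)] at ht ⊢
  have hintegral : ‖(∫ x in r..t, φ k x) - ∫ x in r..t, φ k' x‖ ≤ ε / 3 * |t - r| := by
    rw [← intervalIntegral.integral_sub (hint _ _ _) (hint _ _ _)]
    refine intervalIntegral.norm_integral_le_of_norm_le_const fun x _ => ?_
    rw [← dist_eq_norm]
    exact (hclose x).le
  have hvalue : ‖(t - r) • φ k' r - (t - r) • φ k r‖ ≤ ε / 3 * |t - r| := by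
    rw [← smul_sub, norm_smul, mul_comm, Real.norm_eq_abs, ← dist_eq_norm, dist_comm]
    exact mul_le_mul_of_nonneg_right (hclose r).le (abs_nonneg _)
  calc ‖(∫ x in r..t, φ k x) - (t - r) • φ k r‖
      = ‖((∫ x in r..t, φ k x) - ∫ x in r..t, φ k' x)
          + ((∫ x in r..t, φ k' x) - (t - r) • φ k' r)
          + ((t - r) • φ k' r - (t - r) • φ k r)‖ := by congr 1; abel
    _ ≤ ε / 3 * |t - r| + ε / 3 * ‖t - r‖ + ε / 3 * |t - r| :=
      (norm_add₃_le).trans (add_le_add_three hintegral ht hvalue)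
    _ = ε * ‖t - r‖ := by rw [Real.norm_eq_abs]; ring

/-! ### Families of weak mixed derivatives -/

section WeakMixedFamily

variable {ι : Type*} [DecidableEq ι] {a b x y z : ι → ℝ} {l : ι} {r : ℝ}

theorem update_mem_Icc_iff (hx : x ∈ Icc a b) :
    Function.update x l r ∈ Icc a b ↔ r ∈ Icc (a l) (b l) := by
  rw [mem_Icc, update_le_iff, le_update_iff]
  exact ⟨fun h => ⟨h.1.1, h.2.1⟩, fun h => ⟨⟨h.1, fun i _ => hx.1 i⟩, h.2, fun i _ => hx.2 i⟩⟩

theorem slice_Icc (hx : x ∈ Icc a b) (l : ι) : slice (Icc a b) x l = Icc (a l) (b l) :=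
  Set.ext fun _ => update_mem_Icc_iff hx

/-- `G P`, for `P ⊆ ι`, is the weak mixed derivative `∂^P` of `G ∅` on the box `Icc a b`: it is,
on each segment parallel to the axis `l ∉ P`, a primitive of `G (insert l P)`. All functions are
normalized to be `0` outside the box. -/
structure WeakMixedFamily (a b : ι → ℝ) (G : Finset ι → (ι → ℝ) → ℝ) : Prop where
  measurable : ∀ P, Measurable (G P)
  bounded : ∃ M, ∀ P x, |G P x| ≤ M
  zero : ∀ P, ∀ x ∉ Icc a b, G P x = 0
  sub_eq : ∀ P, ∀ l ∉ P, ∀ x ∈ Icc a b, ∀ z ∈ Icc (a l) (b l),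
    G P x - G P (Function.update x l z) = ∫ r in z..x l, G (insert l P) (Function.update x l r)

namespace WeakMixedFamily

variable {G : Finset ι → (ι → ℝ) → ℝ} {P T : Finset ι}

theorem abs_sub_le (hG : WeakMixedFamily a b G) {M : ℝ} (hM : ∀ P x, |G P x| ≤ M)
    (hT : Disjoint T P) (hx : x ∈ Icc a b) (hy : y ∈ Icc a b) (hxy : ∀ m ∉ T, x m = y m) :
    |G P x - G P y| ≤ M * ∑ m ∈ T, |x m - y m| := by
  induction T using Finset.induction_on generalizing y with
  | empty => simp [funext fun m => hxy m (Finset.notMem_empty m)]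
  | insert m T hm ih =>
    rw [Finset.disjoint_insert_left] at hT
    have hxm : x m ∈ Icc (a m) (b m) := ⟨hx.1 m, hx.2 m⟩
    have hfar := ih hT.2 ((update_mem_Icc_iff hy).2 hxm) fun i hi => by
      by_cases him : i = m
      · subst him; simp
      · rw [Function.update_of_ne him, hxy i (by simp [him, hi])]
    have hsum : ∑ i ∈ T, |x i - Function.update y m (x m) i| = ∑ i ∈ T, |x i - y i| :=
      Finset.sum_congr rfl fun i hi => by
        rw [Function.update_of_ne (ne_of_mem_of_not_mem hi hm)]
    have hnear : |G P (Function.update y m (x m)) - G P y| ≤ M * |x m - y m| := by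
      rw [abs_sub_comm, hG.sub_eq P m hT.1 y hy _ hxm, abs_sub_comm,
        ← Real.norm_eq_abs]
      exact intervalIntegral.norm_integral_le_of_norm_le_const fun r _ =>
        hM (insert m P) (Function.update y m r)
    rw [Finset.sum_insert hm, mul_add]
    rw [hsum] at hfar
    linarith [_root_.abs_sub_le (G P x) (G P (Function.update y m (x m))) (G P y)]

theorem tendstoUniformly_update [Finite ι] (hG : WeakMixedFamily a b G) (l : ι) (y₀ : ι → ℝ)
    (k : {y ∈ Icc a b | ∀ m ∈ P, y m = y₀ m}) :
    TendstoUniformly (fun (y : {y ∈ Icc a b | ∀ m ∈ P, y m = y₀ m}) r =>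
        G (insert l P) (Function.update y.1 l r))
      (fun r => G (insert l P) (Function.update k.1 l r)) (𝓝 k) := by
  cases nonempty_fintype ι
  obtain ⟨M, hM⟩ := hG.bounded
  have hbound : ∀ k' : {y ∈ Icc a b | ∀ m ∈ P, y m = y₀ m}, ∀ r,
      |G (insert l P) (Function.update k.1 l r) - G (insert l P) (Function.update k'.1 l r)|
        ≤ M * ∑ m ∈ (insert l P)ᶜ, |k.1 m - k'.1 m| := fun k' r => by
    by_cases hr : r ∈ Icc (a l) (b l)
    · refine (hG.abs_sub_le hM disjoint_compl_left ((update_mem_Icc_iff k.2.1).2 hr)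
        ((update_mem_Icc_iff k'.2.1).2 hr) fun m hm => ?_).trans_eq ?_
      · rw [Finset.mem_compl, not_not, Finset.mem_insert] at hm
        rcases eq_or_ne m l with rfl | hml
        · simp
        · have hmP := hm.resolve_left hml
          simp [hml, k.2.2 m hmP, k'.2.2 m hmP]
      · refine congrArg (M * ·) (Finset.sum_congr rfl fun m hm => ?_)
        have hml : m ≠ l := by rintro rfl; simp at hm
        rw [Function.update_of_ne hml, Function.update_of_ne hml]
    · rw [hG.zero _ _ ((update_mem_Icc_iff k.2.1).not.2 hr),
        hG.zero _ _ ((update_mem_Icc_iff k'.2.1).not.2 hr), sub_self, abs_zero]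
      exact mul_nonneg ((abs_nonneg _).trans (hM P k.1))
        (Finset.sum_nonneg fun _ _ => abs_nonneg _)
  have hlim : Filter.Tendsto (fun k' : {y ∈ Icc a b | ∀ m ∈ P, y m = y₀ m} =>
      M * ∑ m ∈ (insert l P)ᶜ, |k.1 m - k'.1 m|) (𝓝 k) (𝓝 0) :=
    (continuous_const.mul (continuous_finsetSum _ fun m _ => (continuous_const.sub
      ((continuous_apply m).comp continuous_subtype_val)).abs)).tendsto' k 0 (by simp)
  refine Metric.tendstoUniformly_iff.2 fun ε hε => ?_
  filter_upwards [hlim.eventually_lt_const hε] with k' hk' r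
  exact (hbound k' r).trans_lt hk'

theorem ae_hasDerivAt [Finite ι] (hG : WeakMixedFamily a b G) (hl : l ∉ P) (y₀ : ι → ℝ) :
    ∀ᵐ r, r ∈ Ioo (a l) (b l) → ∀ y ∈ Icc a b, (∀ m ∈ P, y m = y₀ m) →
      HasDerivAt (fun t => G P (Function.update y l t))
        (G (insert l P) (Function.update y l r)) r := by
  obtain ⟨M, hM⟩ := hG.bounded
  have hloc : ∀ y : {y ∈ Icc a b | ∀ m ∈ P, y m = y₀ m},
      LocallyIntegrable fun r => G (insert l P) (Function.update y.1 l r) := fun y =>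
    (locallyIntegrable_const M).mono
      ((hG.measurable _).comp (measurable_update y.1)).aestronglyMeasurable
      (.of_forall fun r => (hM _ _).trans (le_abs_self M))
  filter_upwards [ae_forall_hasDerivAt_integral hloc (hG.tendstoUniformly_update l y₀)]
    with r hr hrI y hy hyP
  have hprim : (fun t => G P (Function.update y l t)) =ᶠ[𝓝 r] fun t =>
      (∫ x in a l..t, G (insert l P) (Function.update y l x))
        + G P (Function.update y l (a l)) := by
    filter_upwards [Icc_mem_nhds hrI.1 hrI.2] with t ht
    have hsub := hG.sub_eq P l hl _ ((update_mem_Icc_iff hy).2 ht) (a l)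
      (left_mem_Icc.2 (hrI.1.trans hrI.2).le)
    simp only [Function.update_idem, Function.update_self] at hsub
    linarith
  exact ((hr ⟨y, hy, hyP⟩ (a l)).add_const _).congr_of_eventuallyEq hprim

theorem ae_partialWithin_eqOn [Finite ι] (hG : WeakMixedFamily a b G) (hl : l ∉ P)
    {g : (ι → ℝ) → ℝ} (hg : EqOn g (G P) {x ∈ Icc a b | ∀ m ∈ P, x m = y m}) :
    ∀ᵐ r, r ∈ Icc (a l) (b l) →
      EqOn (partialWithin (Icc a b) l g) (G (insert l P))
        {x ∈ Icc a b | ∀ m ∈ insert l P, x m = Function.update y l r m} := by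
  filter_upwards [hG.ae_hasDerivAt hl y, Measure.ae_ne volume (a l), Measure.ae_ne volume (b l)]
    with r hderiv hra hrb hr x ⟨hx, hxP⟩
  have hrI : r ∈ Ioo (a l) (b l) := ⟨hr.1.lt_of_ne hra.symm, hr.2.lt_of_ne hrb⟩
  have hxl : x l = r := by rw [hxP l (Finset.mem_insert_self l P), Function.update_self]
  have hxy : ∀ m ∈ P, x m = y m := fun m hm => by
    rw [hxP m (Finset.mem_insert_of_mem hm), Function.update_of_ne (ne_of_mem_of_not_mem hm hl)]
  have hwithin : HasDerivWithinAt (fun t => g (Function.update x l t)) (G (insert l P) x)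
      (Icc (a l) (b l)) r := by
    have := (hderiv hrI x hx hxy).hasDerivWithinAt (s := Icc (a l) (b l))
    rw [← hxl, Function.update_eq_self] at this
    rw [← hxl]
    refine this.congr_of_mem (fun t ht => hg ⟨(update_mem_Icc_iff hx).2 ht, fun m hm => ?_⟩)
      (hxl ▸ hr)
    rw [Function.update_of_ne (ne_of_mem_of_not_mem hm hl), hxy m hm]
  rw [partialWithin, slice_Icc hx, hxl]
  exact hwithin.derivWithin (uniqueDiffOn_Icc (hrI.1.trans hrI.2) r hr)

end WeakMixedFamily

end WeakMixedFamily

/-! ### Mixed differences -/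

section MixedDiff

variable {ι κ : Type*} [DecidableEq ι]

/-- The difference of `g` that arises from moving the coordinates in `t` from `y` to `z`. -/
def blockDiff (z : ι → ℝ) (t : Finset ι) (g : (ι → ℝ) → ℝ) (y : ι → ℝ) : ℝ :=
  g y - g (t.piecewise z y)

/-- The mixed difference of `g` along the blocks `T j`, `j ∈ u`, of coordinates: the composition of
the operators `blockDiff z (T j)`, written out as an alternating sum. -/
def mixedDiff (z : ι → ℝ) (T : κ → Finset ι) (u : Finset κ) (g : (ι → ℝ) → ℝ) (y : ι → ℝ) : ℝ :=
  ∑ w ∈ u.powerset, (-1) ^ w.card * g ((w.biUnion T).piecewise z y)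

variable {z : ι → ℝ} {T : κ → Finset ι} {u : Finset κ} {g h : (ι → ℝ) → ℝ}

theorem piecewise_union (t t' : Finset ι) (z y : ι → ℝ) :
    (t ∪ t').piecewise z y = t.piecewise z (t'.piecewise z y) := by
  ext m
  by_cases h : m ∈ t <;> by_cases h' : m ∈ t' <;> simp [Finset.piecewise, h, h']

theorem mixedDiff_empty (z : ι → ℝ) (T : κ → Finset ι) (g : (ι → ℝ) → ℝ) :
    mixedDiff z T ∅ g = g := by
  ext y
  simp only [mixedDiff, Finset.powerset_empty, Finset.sum_singleton, Finset.card_empty, pow_zero,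
    one_mul]
  exact congrArg g (Finset.piecewise_empty z y)

theorem mixedDiff_insert [DecidableEq κ] {j : κ} (hj : j ∉ u) (z : ι → ℝ) (T : κ → Finset ι)
    (g : (ι → ℝ) → ℝ) : mixedDiff z T (insert j u) g = blockDiff z (T j) (mixedDiff z T u g) := by
  ext y
  rw [mixedDiff, Finset.sum_powerset_insert hj, blockDiff, mixedDiff, mixedDiff,
    sub_eq_add_neg, ← Finset.sum_neg_distrib]
  refine congrArg _ (Finset.sum_congr rfl fun w hw => ?_)
  have hjw : j ∉ w := fun h => hj (Finset.mem_powerset.1 hw h)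
  rw [Finset.card_insert_of_notMem hjw, Finset.biUnion_insert, Finset.union_comm, piecewise_union,
    pow_succ]
  ring

theorem mixedDiff_blockDiff (z : ι → ℝ) (T : κ → Finset ι) (u : Finset κ) (t : Finset ι)
    (g : (ι → ℝ) → ℝ) : mixedDiff z T u (blockDiff z t g) = blockDiff z t (mixedDiff z T u g) := by
  ext y
  simp only [mixedDiff, blockDiff, ← piecewise_union, mul_sub, Finset.sum_sub_distrib]
  exact congrArg _ (Finset.sum_congr rfl fun w _ => by rw [Finset.union_comm])

theorem mixedDiff_eqOn {K : Set (ι → ℝ)} (hK : ∀ w ⊆ u, ∀ y ∈ K, (w.biUnion T).piecewise z y ∈ K)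
    (hgh : EqOn g h K) : EqOn (mixedDiff z T u g) (mixedDiff z T u h) K := fun y hy =>
  Finset.sum_congr rfl fun w hw => by rw [hgh (hK w (Finset.mem_powerset.1 hw) y hy)]

theorem mixedDiff_intervalIntegral {l : ι} (hl : l ∉ u.biUnion T)
    (hg : ∀ y, ∀ p q : ℝ, IntervalIntegrable (fun r => g (Function.update y l r)) volume p q)
    (z y : ι → ℝ) :
    mixedDiff z T u (fun y => ∫ r in z l..y l, g (Function.update y l r)) y =
      ∫ r in z l..y l, mixedDiff z T u g (Function.update y l r) := by
  have hlw : ∀ w ∈ u.powerset, l ∉ w.biUnion T := fun w hw h =>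
    hl (Finset.biUnion_subset_biUnion_of_subset_left T (Finset.mem_powerset.1 hw) h)
  calc mixedDiff z T u (fun y => ∫ r in z l..y l, g (Function.update y l r)) y
      = ∑ w ∈ u.powerset, ∫ r in z l..y l, (-1) ^ w.card *
          g (Function.update ((w.biUnion T).piecewise z y) l r) :=
        Finset.sum_congr rfl fun w hw => by
          beta_reduce
          rw [Finset.piecewise_eq_of_notMem _ _ _ (hlw w hw), intervalIntegral.integral_const_mul]
    _ = ∫ r in z l..y l, ∑ w ∈ u.powerset, (-1) ^ w.card *
          g (Function.update ((w.biUnion T).piecewise z y) l r) :=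
        (intervalIntegral.integral_finsetSum fun w _ => (hg _ _ _).const_mul _).symm
    _ = ∫ r in z l..y l, mixedDiff z T u g (Function.update y l r) := by
        refine intervalIntegral.integral_congr fun r _ => Finset.sum_congr rfl fun w hw => ?_
        rw [Finset.update_piecewise_of_notMem (hi := hlw w hw)]

theorem enorm_blockDiff_le_sum {t : Finset ι} {K : Set (ι → ℝ)} {B : ι → ℝ≥0∞}
    (hK : ∀ y ∈ K, ∀ l, Function.update y l (z l) ∈ K)
    (hB : ∀ l ∈ t, ∀ y ∈ K, ‖blockDiff z {l} g y‖ₑ ≤ B l) {y : ι → ℝ} (hy : y ∈ K) :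
    ‖blockDiff z t g y‖ₑ ≤ ∑ l ∈ t, B l := by
  induction t using Finset.induction_on generalizing y with
  | empty => simp [blockDiff]
  | insert l t hl ih =>
    have htelescope : blockDiff z (insert l t) g y =
        blockDiff z {l} g y + blockDiff z t g (Function.update y l (z l)) := by
      rw [blockDiff, blockDiff, blockDiff, Finset.insert_eq, Finset.union_comm, piecewise_union,
        Finset.piecewise_singleton]
      ring
    rw [htelescope, Finset.sum_insert hl]
    exact (enorm_add_le _ _).trans (add_le_add (hB l (Finset.mem_insert_self l t) y hy)
      (ih (fun m hm => hB m (Finset.mem_insert_of_mem hm)) (hK y hy l)))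

/-! ### Mean value inequality for mixed differences -/

variable {a b p q y : ι → ℝ} {G : Finset ι → (ι → ℝ) → ℝ} {P : Finset ι} {M : ℝ≥0∞} {l : ι}

theorem piecewise_mem_Icc (t : Finset ι) (hz : z ∈ Icc a b) (hy : y ∈ Icc a b) :
    t.piecewise z y ∈ Icc a b :=
  ⟨t.le_piecewise_of_le_of_le hz.1 hy.1, t.piecewise_le_of_le_of_le hz.2 hy.2⟩

theorem WeakMixedFamily.mixedDiff_singleton_insert (hG : WeakMixedFamily a b G)
    (hz : z ∈ Icc a b) {v : Finset ι} (hv : Disjoint v P) (hlv : l ∉ v) (hlP : l ∉ P)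
    (hg : EqOn g (G P) {x ∈ Icc a b | ∀ m ∈ P, x m = y m}) (hy : y ∈ Icc a b) :
    mixedDiff z singleton (insert l v) g y =
      ∫ r in z l..y l, mixedDiff z singleton v (G (insert l P)) (Function.update y l r) := by
  obtain ⟨M, hM⟩ := hG.bounded
  have hzl : z l ∈ Icc (a l) (b l) := ⟨hz.1 l, hz.2 l⟩
  rw [mixedDiff_insert hlv, ← mixedDiff_blockDiff, ← mixedDiff_intervalIntegral (by simpa)]
  · refine mixedDiff_eqOn (K := {x ∈ Icc a b | ∀ m ∈ P, x m = y m}) ?_ ?_ ⟨hy, fun _ _ => rfl⟩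
    · rintro w hw x ⟨hx, hxP⟩
      refine ⟨piecewise_mem_Icc _ hz hx, fun m hm => ?_⟩
      have hmw : m ∉ w := fun h => Finset.disjoint_left.1 hv (hw h) hm
      simpa [Finset.piecewise, hmw] using hxP m hm
    · rintro x ⟨hx, hxP⟩
      beta_reduce
      rw [blockDiff, Finset.piecewise_singleton, ← hG.sub_eq P l hlP x hx _ hzl, hg ⟨hx, hxP⟩,
        hg ⟨(update_mem_Icc_iff hx).2 hzl, fun m hm => ?_⟩]
      rw [Function.update_of_ne (ne_of_mem_of_not_mem hm hlP), hxP m hm]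
  · exact fun x p q => (intervalIntegrable_const (c := M)).mono_fun
      ((hG.measurable _).comp (measurable_update x)).aestronglyMeasurable
      (.of_forall fun r => (hM _ _).trans (le_abs_self M))

theorem WeakMixedFamily.enorm_mixedDiff_singleton_le [Finite ι] (hG : WeakMixedFamily a b G)
    (hpq : Icc p q ⊆ Icc a b) (hz : z ∈ Icc p q) {L : List ι} (hL : L.Nodup)
    (hLP : Disjoint L.toFinset P) (hy : y ∈ Icc p q)
    (hg : EqOn g (G P) {x ∈ Icc a b | ∀ m ∈ P, x m = y m})
    (hM : ∀ x ∈ Icc p q, ‖L.foldr (partialWithin (Icc a b)) g x‖ₑ ≤ M) :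
    ‖mixedDiff z singleton L.toFinset g y‖ₑ ≤ M * ∏ l ∈ L.toFinset, ‖y l - z l‖ₑ := by
  induction L using List.reverseRecOn generalizing P g y with
  | nil => simpa [mixedDiff_empty] using hM y hy
  | append_singleton L l ih =>
    obtain ⟨hLn, -, hlL⟩ := List.nodup_append.1 hL
    replace hlL : l ∉ L.toFinset := fun h => hlL l (List.mem_toFinset.1 h) l (by simp) rfl
    have hins : (L ++ [l]).toFinset = insert l L.toFinset := by ext; simp
    rw [hins, Finset.disjoint_insert_left] at hLP
    rw [hins, hG.mixedDiff_singleton_insert (hpq hz) hLP.2 hlL hLP.1 hg (hpq hy),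
      Finset.prod_insert hlL, mul_comm ‖y l - z l‖ₑ, ← mul_assoc]
    refine enorm_intervalIntegral_le_of_enorm_le ?_
    filter_upwards [hG.ae_partialWithin_eqOn hLP.1 hg] with r hpartial hr
    have hrpq : r ∈ Icc (p l) (q l) :=
      uIcc_subset_Icc ⟨hz.1 l, hz.2 l⟩ ⟨hy.1 l, hy.2 l⟩ (uIoc_subset_uIcc hr)
    have hyr := (update_mem_Icc_iff hy).2 hrpq
    replace hpartial := hpartial ((update_mem_Icc_iff (hpq hy)).1 (hpq hyr))
    have hdisj : Disjoint L.toFinset (insert l P) :=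
      Finset.disjoint_insert_right.2 ⟨hlL, hLP.2⟩
    have hbound := ih hLn hdisj hyr hpartial fun x hx => by simpa using hM x hx
    rw [← mixedDiff_eqOn (K := {x ∈ Icc a b | ∀ m ∈ insert l P, x m = Function.update y l r m})
      ?_ hpartial ⟨hpq hyr, fun _ _ => rfl⟩]
    · refine hbound.trans_eq (congrArg (M * ·) (Finset.prod_congr rfl fun m hm => ?_))
      rw [Function.update_of_ne (ne_of_mem_of_not_mem hm hlL)]
    · rintro w hw x ⟨hx, hxP⟩
      refine ⟨piecewise_mem_Icc _ (hpq hz) hx, fun m hm => ?_⟩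
      have hmw : m ∉ w := fun h => Finset.disjoint_left.1 hdisj (hw h) hm
      simpa [Finset.piecewise, hmw] using hxP m hm

end MixedDiff

/-! ### Transversals of coordinate blocks -/

section Transversals

variable {ι κ : Type*} [DecidableEq ι] {T : κ → Finset ι} {u : Finset κ} {j : κ} {l : ι}
  {v : Finset ι}

/-- The sets that consist of exactly one element of each of the blocks `T j`, `j ∈ u`. -/
def transversals (T : κ → Finset ι) (u : Finset κ) : Finset (Finset ι) :=
  (u.biUnion T).powerset.filter fun v => ∀ j ∈ u, (v ∩ T j).card = 1

theorem mem_transversals :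
    v ∈ transversals T u ↔ v ⊆ u.biUnion T ∧ ∀ j ∈ u, (v ∩ T j).card = 1 := by
  rw [transversals, Finset.mem_filter, Finset.mem_powerset]

theorem biUnion_inter_of_mem_transversals (hv : v ∈ transversals T u) :
    u.biUnion (fun j => v ∩ T j) = v := by
  rw [← Finset.inter_biUnion, Finset.inter_eq_left]
  exact (mem_transversals.1 hv).1

theorem pairwiseDisjoint_inter_left (hT : (u : Set κ).PairwiseDisjoint T) (v : Finset ι) :
    (u : Set κ).PairwiseDisjoint fun j => v ∩ T j :=
  hT.mono fun _ => Finset.inter_subset_right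

theorem card_of_mem_transversals (hT : (u : Set κ).PairwiseDisjoint T)
    (hv : v ∈ transversals T u) : v.card = u.card := by
  rw [← biUnion_inter_of_mem_transversals hv,
    Finset.card_biUnion (pairwiseDisjoint_inter_left hT v),
    Finset.sum_congr rfl (mem_transversals.1 hv).2, Finset.card_eq_sum_ones]

theorem prod_le_prod_of_mem_transversals (hT : (u : Set κ).PairwiseDisjoint T)
    (hv : v ∈ transversals T u) {c : ι → ℝ≥0∞} {δ : κ → ℝ≥0∞}
    (hc : ∀ j ∈ u, ∀ l ∈ T j, c l ≤ δ j) : ∏ l ∈ v, c l ≤ ∏ j ∈ u, δ j := by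
  conv_lhs => rw [← biUnion_inter_of_mem_transversals hv]
  rw [Finset.prod_biUnion (pairwiseDisjoint_inter_left hT v)]
  refine Finset.prod_le_prod' fun j hj => ?_
  obtain ⟨l, hl⟩ := Finset.card_eq_one.1 ((mem_transversals.1 hv).2 j hj)
  have hlT : l ∈ T j := Finset.inter_subset_right (hl ▸ Finset.mem_singleton_self l)
  simpa only [hl, Finset.prod_singleton] using hc j hj l hlT

theorem disjoint_block_of_mem_transversals [DecidableEq κ]
    (hT : ((insert j u : Finset κ) : Set κ).PairwiseDisjoint T) (hj : j ∉ u)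
    (hv : v ∈ transversals T u) : Disjoint v (T j) := by
  refine ((Finset.disjoint_biUnion_left u T (T j)).2 fun i hi => ?_).mono_left
    (mem_transversals.1 hv).1
  exact hT (Finset.mem_insert_of_mem hi) (Finset.mem_insert_self j u) (ne_of_mem_of_not_mem hi hj)

theorem insert_mem_transversals [DecidableEq κ]
    (hT : ((insert j u : Finset κ) : Set κ).PairwiseDisjoint T) (hj : j ∉ u)
    (hl : l ∈ T j) (hv : v ∈ transversals T u) :
    insert l v ∈ transversals T (insert j u) := by
  have hvj := disjoint_block_of_mem_transversals hT hj hv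
  rw [mem_transversals] at hv ⊢
  rw [Finset.biUnion_insert, Finset.forall_mem_insert]
  refine ⟨Finset.insert_subset (Finset.mem_union_left _ hl)
    (hv.1.trans Finset.subset_union_right), ?_, fun i hi => ?_⟩
  · rw [Finset.insert_inter_of_mem hl, Finset.disjoint_iff_inter_eq_empty.1 hvj]
    rfl
  · have hli : l ∉ T i := Finset.disjoint_left.1 (hT (Finset.mem_insert_self j u)
      (Finset.mem_insert_of_mem hi) (ne_of_mem_of_not_mem hi hj).symm) hl
    rw [Finset.insert_inter_of_notMem hli, hv.2 i hi]

theorem sum_sum_insert_le_sum_transversals [DecidableEq κ]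
    (hT : ((insert j u : Finset κ) : Set κ).PairwiseDisjoint T) (hj : j ∉ u)
    (A : Finset ι → ℝ≥0∞) :
    ∑ l ∈ T j, ∑ v ∈ transversals T u, A (insert l v) ≤
      ∑ v ∈ transversals T (insert j u), A v := by
  have hinj : InjOn (fun x : ι × Finset ι => insert x.1 x.2)
      (T j ×ˢ transversals T u : Finset _) := by
    rintro ⟨l, v⟩ hlv ⟨l', v'⟩ hlv' h
    rw [Finset.mem_coe, Finset.mem_product] at hlv hlv'
    have hv := disjoint_block_of_mem_transversals hT hj hlv.2
    have hv' := disjoint_block_of_mem_transversals hT hj hlv'.2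
    have hl : l = l' := by
      simpa [Finset.insert_inter_of_mem hlv.1, Finset.insert_inter_of_mem hlv'.1,
        Finset.disjoint_iff_inter_eq_empty.1 hv, Finset.disjoint_iff_inter_eq_empty.1 hv']
        using congrArg (· ∩ T j) h
    have hvv : v = v' := by
      simpa [Finset.insert_sdiff_of_mem _ hlv.1, Finset.insert_sdiff_of_mem _ hlv'.1,
        Finset.sdiff_eq_self_of_disjoint hv, Finset.sdiff_eq_self_of_disjoint hv']
        using congrArg (· \ T j) h
    rw [hl, hvv]
  rw [← Finset.sum_product', ← Finset.sum_image (f := A) hinj]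
  refine Finset.sum_le_sum_of_subset (Finset.image_subset_iff.2 fun x hx => ?_)
  rw [Finset.mem_product] at hx
  exact insert_mem_transversals hT hj hx.1 hx.2

theorem enorm_mixedDiff_le_sum_transversals (hT : (u : Set κ).PairwiseDisjoint T) {z : ι → ℝ}
    {K : Set (ι → ℝ)} (hK : ∀ y ∈ K, ∀ l, Function.update y l (z l) ∈ K) {g : (ι → ℝ) → ℝ}
    {A : Finset ι → ℝ≥0∞}
    (hA : ∀ v ∈ transversals T u, ∀ y ∈ K, ‖mixedDiff z singleton v g y‖ₑ ≤ A v) {y : ι → ℝ}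
    (hy : y ∈ K) : ‖mixedDiff z T u g y‖ₑ ≤ ∑ v ∈ transversals T u, A v := by
  classical
  induction u using Finset.induction_on generalizing g A y with
  | empty => simpa [transversals, mixedDiff_empty] using hA ∅ (by simp [transversals]) y hy
  | insert j u hj ih =>
    rw [mixedDiff_insert hj]
    refine (enorm_blockDiff_le_sum hK (fun l hl x hx => ?_) hy).trans
      (sum_sum_insert_le_sum_transversals hT hj A)
    rw [← mixedDiff_blockDiff]
    refine ih (hT.subset (by simp)) (fun v hv x hx => ?_) hx
    have hlv : l ∉ v := Finset.disjoint_right.1 (disjoint_block_of_mem_transversals hT hj hv) hl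
    rw [mixedDiff_blockDiff, ← mixedDiff_insert hlv]
    exact hA _ (insert_mem_transversals hT hj hl hv) x hx

end Transversals

section CoordBlock

/-- The coordinates of the `j`-th component of a point of `(ℝ^d)^J`. -/
def coordBlock {J : Type*} (d : ℕ) (j : J) : Finset (J × Fin d) :=
  {j} ×ˢ Finset.univ

theorem mem_coordBlock {J : Type*} {d : ℕ} {j : J} {l : J × Fin d} :
    l ∈ coordBlock d j ↔ l.1 = j := by
  simp [coordBlock, -Finset.singleton_product]

theorem pairwiseDisjoint_coordBlock {J : Type*} (d : ℕ) (A : Set J) :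
    A.PairwiseDisjoint (coordBlock d) := fun _ _ _ _ hjk =>
  Finset.disjoint_left.2 fun _ hj hk => hjk ((mem_coordBlock.1 hj).symm.trans (mem_coordBlock.1 hk))

variable {s d : ℕ} {a b p q y z : Fin s × Fin d → ℝ}

theorem transversals_coordBlock_subset_touching (u : Finset (Fin s)) :
    transversals (coordBlock d) u ⊆ touching d u := fun v hv => by
  rw [mem_transversals] at hv
  refine Finset.mem_filter.2 ⟨Finset.mem_powerset.2 fun l hl => ?_, fun j hj => ?_⟩
  · obtain ⟨j, hj, hlj⟩ := Finset.mem_biUnion.1 (hv.1 hl)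
    rw [Finset.mem_product, mem_coordBlock.1 hlj]
    exact ⟨hj, Finset.mem_univ _⟩
  · exact Finset.card_pos.1 ((hv.2 j hj).symm ▸ one_pos)

/-- `D` is a box on which `e` has weak mixed derivatives, once with respect to each coordinate of
any set of coordinates. -/
def HasWeakMixedDerivsOn {ι : Type*} [DecidableEq ι] (D : Set (ι → ℝ)) (e : (ι → ℝ) → ℝ) : Prop :=
  ∃ a b, D = Icc a b ∧ ∃ G, WeakMixedFamily a b G ∧ EqOn e (G ∅) D

variable {D : Set (Fin s × Fin d → ℝ)} {e : (Fin s × Fin d → ℝ) → ℝ}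

theorem exists_mixedPartial_eq_foldr {s d : ℕ} (v : Finset (Fin s × Fin d)) :
    ∃ L : List (Fin s × Fin d), L.Nodup ∧ L.toFinset = v ∧
      ∀ D g, mixedPartial D g v = L.foldr (partialWithin D) g :=
  ⟨_, ((List.nodup_finRange s).product (List.nodup_finRange d)).filter _, by ext ⟨j, i⟩; simp,
    fun _ _ => rfl⟩

theorem HasWeakMixedDerivsOn.enorm_mixedDiff_singleton_le (he : HasWeakMixedDerivsOn D e)
    (hpq : Icc p q ⊆ D) (hz : z ∈ Icc p q) (hy : y ∈ Icc p q) (v : Finset (Fin s × Fin d)) :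
    ‖mixedDiff z singleton v e y‖ₑ ≤
      (⨆ x ∈ Icc p q, ‖mixedPartial D e v x‖ₑ) * ∏ l ∈ v, ‖y l - z l‖ₑ := by
  obtain ⟨a, b, rfl, G, hG, heG⟩ := he
  obtain ⟨L, hL, rfl, hpartial⟩ := exists_mixedPartial_eq_foldr v
  simp only [hpartial]
  exact hG.enorm_mixedDiff_singleton_le (P := ∅) (g := e) hpq hz hL (by simp) hy
    (heG.mono fun x hx => hx.1) fun x hx => le_iSup₂_of_le x hx le_rfl

theorem HasWeakMixedDerivsOn.enorm_mixedDiff_coordBlock_le (he : HasWeakMixedDerivsOn D e)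
    (hpq : Icc p q ⊆ D) {u : Finset (Fin s)} {δ : Fin s → ℝ≥0∞}
    (hδ : ∀ j ∈ u, ∀ i, ENNReal.ofReal (q (j, i) - p (j, i)) ≤ δ j) (hz : z ∈ Icc p q)
    (hy : y ∈ Icc p q) :
    ‖mixedDiff z (coordBlock d) u e y‖ₑ ≤ (∏ j ∈ u, δ j) *
      ∑ v ∈ transversals (coordBlock d) u, ⨆ x ∈ Icc p q, ‖mixedPartial D e v x‖ₑ := by
  rw [Finset.mul_sum]
  refine enorm_mixedDiff_le_sum_transversals (pairwiseDisjoint_coordBlock d _) (K := Icc p q)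
    (fun x hx l => (update_mem_Icc_iff hx).2 ⟨hz.1 l, hz.2 l⟩) (fun v hv x hx => ?_) hy
  rw [mul_comm]
  refine (he.enorm_mixedDiff_singleton_le hpq hz hx v).trans (mul_le_mul_right ?_ _)
  refine prod_le_prod_of_mem_transversals (pairwiseDisjoint_coordBlock d _) hv fun j hj l hl => ?_
  obtain rfl := mem_coordBlock.1 hl
  refine le_trans ?_ (hδ l.1 hj l.2)
  rw [Real.enorm_eq_ofReal_abs]
  exact ENNReal.ofReal_le_ofReal
    (abs_sub_le_of_le_of_le (hx.1 l) (hx.2 l) (hz.1 l) (hz.2 l))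

end CoordBlock

/-! ### Integrals over products of regions -/

theorem volume_preserving_curry (J K : Type*) [Fintype J] [Fintype K] (E : Type*)
    [MeasureSpace E] [SigmaFinite (volume : Measure E)] :
    MeasurePreserving (MeasurableEquiv.curry J K E) := by
  refine MeasurePreserving.symm (MeasurableEquiv.curry J K E).symm
    ⟨MeasurableEquiv.measurable _, (Measure.pi_eq fun B _ => ?_).symm⟩
  have hpreimage : (MeasurableEquiv.curry J K E).symm ⁻¹' univ.pi B =
      univ.pi fun j => univ.pi fun i => B (j, i) := by
    ext w
    simp [MeasurableEquiv.curry, Set.mem_pi]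
  rw [MeasurableEquiv.map_apply, hpreimage, volume_pi_pi, Fintype.prod_prod_type]
  exact Finset.prod_congr rfl fun j _ => volume_pi_pi _

section ProductMeasure

variable {J : Type*} {d : ℕ} {X : J → Set (EuclideanSpace ℝ (Fin d))}

/-- The measurable equivalence `component` of `ℝ^(J × Fin d)` with `(ℝ^d)^J`. -/
noncomputable def componentEquiv (J : Type*) (d : ℕ) :
    (J × Fin d → ℝ) ≃ᵐ (J → EuclideanSpace ℝ (Fin d)) :=
  (MeasurableEquiv.curry J (Fin d) ℝ).trans
    (MeasurableEquiv.piCongrRight fun _ => MeasurableEquiv.toLp 2 (Fin d → ℝ))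

theorem coe_componentEquiv (J : Type*) (d : ℕ) : ⇑(componentEquiv J d) = component := rfl

theorem prodSet_eq_preimage (X : J → Set (EuclideanSpace ℝ (Fin d))) :
    prodSet X = componentEquiv J d ⁻¹' univ.pi X := by
  ext x
  simp [prodSet, coe_componentEquiv]

theorem measurableSet_prodSet [Countable J] (hX : ∀ j, MeasurableSet (X j)) :
    MeasurableSet (prodSet X) := by
  rw [prodSet_eq_preimage]
  exact (componentEquiv J d).measurable (MeasurableSet.univ_pi hX)

variable [Fintype J]

theorem volume_preserving_componentEquiv : MeasurePreserving (componentEquiv J d) :=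
  (volume_preserving_pi fun _ => PiLp.volume_preserving_toLp (Fin d)).comp
    (volume_preserving_curry J (Fin d) ℝ)

theorem measurePreserving_componentEquiv_restrict (X : J → Set (EuclideanSpace ℝ (Fin d))) :
    MeasurePreserving (componentEquiv J d) (volume.restrict (prodSet X))
      (Measure.pi fun j => volume.restrict (X j)) := by
  rw [← Measure.restrict_pi_pi, prodSet_eq_preimage]
  exact volume_preserving_componentEquiv.restrict_preimage_emb
    (componentEquiv J d).measurableEmbedding _

theorem setIntegral_prodSet_prod (Ψ : J → EuclideanSpace ℝ (Fin d) → ℝ) :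
    ∫ x in prodSet X, ∏ j, Ψ j (component x j) = ∏ j, ∫ x in X j, Ψ j x := by
  rw [← integral_fintype_prod_eq_prod (𝕜 := ℝ) Ψ (μ := fun j => volume.restrict (X j)),
    ← (measurePreserving_componentEquiv_restrict X).integral_comp
      (componentEquiv J d).measurableEmbedding]
  rfl

theorem isProbabilityMeasure_restrict {E : Type*} [MeasureSpace E] {A : Set E}
    (hA : volume A = 1) : IsProbabilityMeasure (volume.restrict A) :=
  ⟨by rw [Measure.restrict_apply_univ, hA]⟩

theorem isProbabilityMeasure_prodSet (hv : ∀ j, volume (X j) = 1) :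
    IsProbabilityMeasure (volume.restrict (prodSet X)) := by
  have := fun j => isProbabilityMeasure_restrict (hv j)
  exact ⟨by rw [← preimage_univ (f := componentEquiv J d),
    (measurePreserving_componentEquiv_restrict X).measure_preimage nullMeasurableSet_univ,
    measure_univ]⟩

theorem setIntegral_prodSet_comp_component (hv : ∀ j, volume (X j) = 1) (j : J)
    {Ψ : EuclideanSpace ℝ (Fin d) → ℝ} (hΨ : Measurable Ψ) :
    ∫ x in prodSet X, Ψ (component x j) = ∫ x in X j, Ψ x := by
  have := fun j => isProbabilityMeasure_restrict (hv j)
  have hmp := (measurePreserving_eval (fun j => volume.restrict (X j)) j).comp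
    (measurePreserving_componentEquiv_restrict X)
  rw [← hmp.map_eq, integral_map hmp.measurable.aemeasurable hΨ.aestronglyMeasurable]
  rfl

end ProductMeasure

theorem measurePreserving_pi_glue {I : Type*} [Fintype I] [DecidableEq I] {E : I → Type*}
    [∀ i, MeasurableSpace (E i)] (μ : ∀ i, Measure (E i)) [∀ i, IsProbabilityMeasure (μ i)]
    (u : Finset I) :
    MeasurePreserving (fun (q : (∀ i, E i) × (∀ i : {i // i ∉ u}, E i)) (i : I) =>
        if h : i ∈ u then q.1 i else q.2 ⟨i, h⟩)
      ((Measure.pi μ).prod (Measure.pi fun i : {i // i ∉ u} => μ i)) (Measure.pi μ) :=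
  have hsplit := measurePreserving_piEquivPiSubtypeProd μ (· ∈ u)
  (hsplit.symm _).comp ((measurePreserving_fst.comp hsplit).prod (MeasurePreserving.id _))

section Region

variable {s d : ℕ} {X : Fin s → Set (EuclideanSpace ℝ (Fin d))} {u : Finset (Fin s)}
  {g ψ : (Fin s × Fin d → ℝ) → ℝ}

theorem component_glue_of_mem {j : Fin s} (hj : j ∈ u) (x : Fin s × Fin d → ℝ)
    (y : {j : Fin s // j ∉ u} × Fin d → ℝ) : component (glue u x y) j = component x j := by
  ext i
  simp [component, glue, hj]

theorem component_glue_of_notMem {j : Fin s} (hj : j ∉ u) (x : Fin s × Fin d → ℝ)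
    (y : {j : Fin s // j ∉ u} × Fin d → ℝ) : component (glue u x y) j = component y ⟨j, hj⟩ := by
  ext i
  simp [component, glue, hj]

theorem measurePreserving_glue (hv : ∀ j, volume (X j) = 1) (u : Finset (Fin s)) :
    MeasurePreserving (fun q : (Fin s × Fin d → ℝ) × ({j : Fin s // j ∉ u} × Fin d → ℝ) =>
        glue u q.1 q.2)
      ((volume.restrict (prodSet X)).prod
        (volume.restrict (prodSet fun j : {j : Fin s // j ∉ u} => X j.1)))
      (volume.restrict (prodSet X)) := by
  have := fun j => isProbabilityMeasure_restrict (hv j)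
  convert ((measurePreserving_componentEquiv_restrict X).symm _).comp
    ((measurePreserving_pi_glue (fun j => volume.restrict (X j)) u).comp
      ((measurePreserving_componentEquiv_restrict X).prod
        (measurePreserving_componentEquiv_restrict fun j : {j : Fin s // j ∉ u} => X j.1))) using 1
  funext q
  rw [Function.comp_apply, MeasurableEquiv.eq_symm_apply, coe_componentEquiv]
  funext j
  by_cases hj : j ∈ u
  · simp [component_glue_of_mem hj, hj, coe_componentEquiv]
  · simp [component_glue_of_notMem hj, hj, coe_componentEquiv]

theorem integrableOn_integralOut (hv : ∀ j, volume (X j) = 1) (u : Finset (Fin s))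
    (hg : IntegrableOn g (prodSet X)) : IntegrableOn (integralOut X u g) (prodSet X) :=
  ((measurePreserving_glue hv u).integrable_comp_of_integrable hg).integral_prod_left

theorem setIntegral_integralOut (hv : ∀ j, volume (X j) = 1) (u : Finset (Fin s))
    (hg : IntegrableOn g (prodSet X)) :
    ∫ x in prodSet X, integralOut X u g x = ∫ x in prodSet X, g x := by
  have hglue := measurePreserving_glue hv u
  have hgm := hg.aestronglyMeasurable
  rw [← hglue.map_eq] at hgm
  conv_rhs => rw [← hglue.map_eq]
  rw [integral_map hglue.measurable.aemeasurable hgm]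
  exact (integral_prod _ (hglue.integrable_comp_of_integrable hg)).symm

theorem setIntegral_integralOut_mul (hX : ∀ j, MeasurableSet (X j)) (hv : ∀ j, volume (X j) = 1)
    (hψ : ∀ x ∈ prodSet X, ∀ y ∈ prodSet fun j : {j : Fin s // j ∉ u} => X j.1,
      ψ (glue u x y) = ψ x)
    (hint : IntegrableOn (fun x => g x * ψ x) (prodSet X)) :
    ∫ x in prodSet X, integralOut X u g x * ψ x = ∫ x in prodSet X, g x * ψ x := by
  rw [← setIntegral_integralOut hv u hint]
  refine setIntegral_congr_fun (measurableSet_prodSet hX) fun x hx => ?_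
  simp only [integralOut]
  rw [← integral_mul_const]
  exact setIntegral_congr_fun (measurableSet_prodSet fun j => hX j.1) fun y hy => by
    rw [hψ x hx y hy]

variable {Ψ : Fin s → EuclideanSpace ℝ (Fin d) → ℝ}

theorem setIntegral_mul_prod_eq_zero (hv : ∀ j, volume (X j) = 1) {j : Fin s}
    (hΨm : Measurable (Ψ j)) (hΨ : ∫ x in X j, Ψ j x = 0) (hg : DependsOn g {p | p.1 ≠ j}) :
    ∫ x in prodSet X, g x * ∏ i, Ψ i (component x i) = 0 := by
  by_cases hint : IntegrableOn (fun x => g x * ∏ i, Ψ i (component x i)) (prodSet X)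
  swap
  · exact integral_undef hint
  rw [← setIntegral_integralOut hv {j}ᶜ hint]
  refine integral_eq_zero_of_ae (.of_forall fun x => ?_)
  have hj : j ∉ ({j}ᶜ : Finset (Fin s)) := by simp
  have hfactor : ∀ y : {i : Fin s // i ∉ ({j}ᶜ : Finset (Fin s))} × Fin d → ℝ,
      g (glue {j}ᶜ x y) * ∏ i, Ψ i (component (glue {j}ᶜ x y) i) =
        g x * (∏ i ∈ {j}ᶜ, Ψ i (component x i)) * Ψ j (component y ⟨j, hj⟩) := fun y => by
    rw [hg (y := x) fun p hp => dif_pos (by simpa using hp), ← Finset.prod_compl_mul_prod {j},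
      Finset.prod_singleton, component_glue_of_notMem hj, mul_assoc,
      Finset.prod_congr rfl fun i hi => by rw [component_glue_of_mem hi]]
  simp only [integralOut, hfactor, Pi.zero_apply]
  rw [integral_const_mul, setIntegral_prodSet_comp_component
    (X := fun i : {i : Fin s // i ∉ ({j}ᶜ : Finset (Fin s))} => X i) (fun i => hv i) ⟨j, hj⟩ hΨm,
    hΨ, mul_zero]

theorem setIntegral_mixedDiff_mul_prod (hv : ∀ j, volume (X j) = 1)
    (hΨm : ∀ j ∈ u, Measurable (Ψ j)) (hΨ : ∀ j ∈ u, ∫ x in X j, Ψ j x = 0)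
    (z : Fin s × Fin d → ℝ)
    (hint : ∀ w ⊆ u, IntegrableOn (fun x => g ((w.biUnion (coordBlock d)).piecewise z x) *
      ∏ i, Ψ i (component x i)) (prodSet X)) :
    ∫ x in prodSet X, mixedDiff z (coordBlock d) u g x * ∏ i, Ψ i (component x i) =
      ∫ x in prodSet X, g x * ∏ i, Ψ i (component x i) := by
  simp only [mixedDiff, Finset.sum_mul, mul_assoc]
  rw [integral_finsetSum _ fun w hw => (hint w (Finset.mem_powerset.1 hw)).const_mul _,
    Finset.sum_eq_single_of_mem ∅ (Finset.empty_mem_powerset u)]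
  · refine integral_congr_ae (.of_forall fun x => ?_)
    simp only [Finset.biUnion_empty, Finset.card_empty, pow_zero, one_mul]
    exact congrArg (g · * _) (Finset.piecewise_empty z x)
  · intro w hw hw_ne
    obtain ⟨j, hj⟩ := Finset.nonempty_iff_ne_empty.2 hw_ne
    have hju := Finset.mem_powerset.1 hw hj
    have hindep : DependsOn (fun x => g ((w.biUnion (coordBlock d)).piecewise z x))
        {p | p.1 ≠ j} := fun x y hxy => by
      refine congrArg g (funext fun p => ?_)
      by_cases hp : p ∈ w.biUnion (coordBlock d)
      · rw [Finset.piecewise_eq_of_mem _ _ _ hp, Finset.piecewise_eq_of_mem _ _ _ hp]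
      · rw [Finset.piecewise_eq_of_notMem _ _ _ hp, Finset.piecewise_eq_of_notMem _ _ _ hp]
        exact hxy p fun hpj => hp (Finset.mem_biUnion.2 ⟨j, hj, mem_coordBlock.2 hpj⟩)
    rw [integral_const_mul, setIntegral_mul_prod_eq_zero hv (hΨm j hju) (hΨ j hju) hindep,
      mul_zero]

end Region

/-! ### Cells and the multiresolution basis -/

section Haar

variable {d b : ℕ} {A : Set (EuclideanSpace ℝ (Fin d))} (S : RecursiveSplit b A) {k t : ℕ}

theorem mul_add_lt_pow_succ (ht : t < b ^ k) (c : Fin b) : b * t + c < b ^ (k + 1) :=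
  calc b * t + c < b * t + b := by omega
    _ = b * (t + 1) := by ring
    _ ≤ b ^ (k + 1) := by rw [pow_succ']; exact Nat.mul_le_mul_left _ ht

theorem exists_mul_add_eq (ht : t < b ^ (k + 1)) :
    ∃ t', t' < b ^ k ∧ ∃ c : Fin b, b * t' + c = t :=
  have hb : 0 < b := Nat.pos_of_ne_zero (by rintro rfl; simp at ht)
  ⟨t / b, Nat.div_lt_of_lt_mul (by rwa [← pow_succ']), ⟨t % b, Nat.mod_lt t hb⟩,
    Nat.div_add_mod t b⟩

namespace RecursiveSplit

theorem measurableSet_cell (ht : t < b ^ k) : MeasurableSet (S.cell k t) := by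
  rw [(S.isSplit k t ht).union]
  exact .iUnion (S.isSplit k t ht).borel

theorem measurableSet (S : RecursiveSplit b A) : MeasurableSet A := by
  rw [← S.cell_zero]
  exact S.measurableSet_cell (by simp)

theorem child_subset_cell (ht : t < b ^ k) (c : Fin b) :
    S.cell (k + 1) (b * t + c) ⊆ S.cell k t := by
  rw [(S.isSplit k t ht).union]
  exact subset_iUnion (fun c : Fin b => S.cell (k + 1) (b * t + c)) c

theorem cell_subset (ht : t < b ^ k) : S.cell k t ⊆ A := by
  induction k generalizing t with
  | zero =>
    obtain rfl : t = 0 := by simpa using ht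
    rw [S.cell_zero]
  | succ k ih =>
    obtain ⟨t', ht', c, rfl⟩ := exists_mul_add_eq ht
    exact (S.child_subset_cell ht' c).trans (ih ht')

theorem volume_cell (hA : volume A = 1) (ht : t < b ^ k) :
    volume (S.cell k t) = ((b : ℝ≥0∞) ^ k)⁻¹ := by
  induction k generalizing t with
  | zero =>
    obtain rfl : t = 0 := by simpa using ht
    rw [S.cell_zero, hA, pow_zero, inv_one]
  | succ k ih =>
    obtain ⟨t', ht', c, rfl⟩ := exists_mul_add_eq ht
    rw [(S.isSplit k t' ht').volume_eq c, ih ht', div_eq_mul_inv, pow_succ,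
      ENNReal.mul_inv (.inr (ENNReal.natCast_ne_top b))
        (.inl (ENNReal.pow_ne_top (ENNReal.natCast_ne_top b)))]

theorem integrableOn_indicator_cell (hA : volume A = 1) (ht : t < b ^ k) :
    IntegrableOn (fun x => (S.cell k t).indicator (1 : EuclideanSpace ℝ (Fin d) → ℝ) x) A :=
  have := isProbabilityMeasure_restrict hA
  (integrable_const (1 : ℝ)).indicator (S.measurableSet_cell ht)

theorem setIntegral_indicator_cell (hA : volume A = 1) (ht : t < b ^ k) :
    ∫ x in A, (S.cell k t).indicator (1 : EuclideanSpace ℝ (Fin d) → ℝ) x = ((b : ℝ) ^ k)⁻¹ := by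
  rw [integral_indicator_one (S.measurableSet_cell ht), measureReal_restrict_apply
    (S.measurableSet_cell ht), inter_eq_left.2 (S.cell_subset ht), measureReal_def,
    S.volume_cell hA ht]
  simp

theorem setIntegral_indicator_child_add_indicator_cell (hA : volume A = 1) (ht : t < b ^ k)
    (c : Fin b) (α β : ℝ) :
    ∫ x in A, (α * (S.cell (k + 1) (b * t + c)).indicator 1 x + β * (S.cell k t).indicator 1 x) =
      (α / b + β) / (b : ℝ) ^ k := by
  have hchild := mul_add_lt_pow_succ ht c
  rw [integral_add ((S.integrableOn_indicator_cell hA hchild).const_mul α)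
      ((S.integrableOn_indicator_cell hA ht).const_mul β), integral_const_mul,
    integral_const_mul, S.setIntegral_indicator_cell hA hchild, S.setIntegral_indicator_cell hA ht,
    pow_succ, mul_inv]
  ring

end RecursiveSplit

theorem measurable_haar (ht : t < b ^ k) (c : Fin b) : Measurable (haar S k t c) :=
  ((measurable_one.indicator (S.measurableSet_cell (mul_add_lt_pow_succ ht c))).const_mul _).sub
    ((measurable_one.indicator (S.measurableSet_cell ht)).const_mul _)

theorem haar_eq_zero_of_notMem_cell (ht : t < b ^ k) (c : Fin b) {x : EuclideanSpace ℝ (Fin d)}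
    (hx : x ∉ S.cell k t) : haar S k t c x = 0 := by
  have hchild : x ∉ S.cell (k + 1) (b * t + c) := fun h => hx (S.child_subset_cell ht c h)
  simp [haar, hx, hchild]

theorem haar_eq_mul (c : Fin b) (x : EuclideanSpace ℝ (Fin d)) :
    haar S k t c x = (b : ℝ) ^ (((k : ℝ) - 1) / 2) *
      (b * (S.cell (k + 1) (b * t + c)).indicator 1 x + -1 * (S.cell k t).indicator 1 x) := by
  have hcoeff : (b : ℝ) ^ (((k : ℝ) + 1) / 2) = (b : ℝ) ^ (((k : ℝ) - 1) / 2) * b := by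
    rw [← Real.rpow_add_one (by exact_mod_cast c.pos.ne')]
    ring_nf
  rw [haar, hcoeff]
  ring

theorem abs_haar (ht : t < b ^ k) (c : Fin b) (x : EuclideanSpace ℝ (Fin d)) :
    |haar S k t c x| = (b : ℝ) ^ (((k : ℝ) - 1) / 2) *
      ((b - 2) * (S.cell (k + 1) (b * t + c)).indicator 1 x + 1 * (S.cell k t).indicator 1 x) := by
  have hb : (1 : ℝ) ≤ b := by exact_mod_cast c.pos
  rw [haar_eq_mul, abs_mul, abs_of_nonneg (Real.rpow_nonneg (Nat.cast_nonneg b) _)]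
  congr 1
  by_cases hchild : x ∈ S.cell (k + 1) (b * t + c)
  · simp only [hchild, S.child_subset_cell ht c hchild, indicator_of_mem, Pi.one_apply]
    rw [abs_of_nonneg (by linarith)]
    ring
  · by_cases hcell : x ∈ S.cell k t <;> simp [hchild, hcell]

theorem setIntegral_haar (hA : volume A = 1) (ht : t < b ^ k) (c : Fin b) :
    ∫ x in A, haar S k t c x = 0 := by
  have hb : (b : ℝ) ≠ 0 := by exact_mod_cast c.pos.ne'
  simp only [haar_eq_mul]
  rw [integral_const_mul, S.setIntegral_indicator_child_add_indicator_cell hA ht, div_self hb]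
  simp

theorem setIntegral_abs_haar (hA : volume A = 1) (ht : t < b ^ k) (c : Fin b) :
    ∫ x in A, |haar S k t c x| = (2 - 2 / (b : ℝ)) * (b : ℝ) ^ (-((k : ℝ) / 2) - 1 / 2) := by
  have hb : (0 : ℝ) < b := by exact_mod_cast c.pos
  have hpow : (b : ℝ) ^ (((k : ℝ) - 1) / 2) / (b : ℝ) ^ k = (b : ℝ) ^ (-((k : ℝ) / 2) - 1 / 2) := by
    rw [← Real.rpow_natCast, ← Real.rpow_sub hb]
    ring_nf
  simp only [abs_haar S ht]
  rw [integral_const_mul, S.setIntegral_indicator_child_add_indicator_cell hA ht, ← hpow]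
  field_simp
  ring

theorem abs_haar_le (c : ℕ) (x : EuclideanSpace ℝ (Fin d)) :
    |haar S k t c x| ≤ (b : ℝ) ^ (((k : ℝ) + 1) / 2) + (b : ℝ) ^ (((k : ℝ) - 1) / 2) := by
  have hterm : ∀ (e : ℝ) (B : Set (EuclideanSpace ℝ (Fin d))),
      |(b : ℝ) ^ e * B.indicator 1 x| ≤ (b : ℝ) ^ e := fun e B => by
    have hpow : 0 ≤ (b : ℝ) ^ e := Real.rpow_nonneg (Nat.cast_nonneg b) e
    by_cases hx : x ∈ B <;> simp [hx, hpow, abs_of_nonneg hpow]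
  exact (abs_sub _ _).trans (add_le_add (hterm _ _) (hterm _ _))

end Haar

section MultiHaar

variable {s d b : ℕ} {X : Fin s → Set (EuclideanSpace ℝ (Fin d))}
  (S : ∀ j, RecursiveSplit b (X j)) (u : Finset (Fin s)) (κ : u → ℕ)
  (τ : ∀ j : u, Fin (b ^ κ j)) (γ : u → Fin b)

/-- The univariate factors of `multiHaar`: the wavelets `ψ_{k_j t_j c_j}` for `j ∈ u` and the
scaling functions `φ_j = 1_{X j}` for `j ∉ u`. -/
noncomputable def multiHaarFactor (j : Fin s) (x : EuclideanSpace ℝ (Fin d)) : ℝ :=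
  if h : j ∈ u then haar (S j) (κ ⟨j, h⟩) (τ ⟨j, h⟩) (γ ⟨j, h⟩) x else (X j).indicator 1 x

/-- The factors of `cellProd`: the cells `X_{j,(k_j,t_j)}` for `j ∈ u` and `X j` for `j ∉ u`. -/
def cellFactor (j : Fin s) : Set (EuclideanSpace ℝ (Fin d)) :=
  if h : j ∈ u then (S j).cell (κ ⟨j, h⟩) (τ ⟨j, h⟩) else X j

variable {u}

theorem multiHaarFactor_of_mem {j : Fin s} (hj : j ∈ u) :
    multiHaarFactor S u κ τ γ j = haar (S j) (κ ⟨j, hj⟩) (τ ⟨j, hj⟩) (γ ⟨j, hj⟩) :=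
  funext fun _ => dif_pos hj

theorem multiHaarFactor_of_notMem {j : Fin s} (hj : j ∉ u) :
    multiHaarFactor S u κ τ γ j = (X j).indicator 1 :=
  funext fun _ => dif_neg hj

theorem cellFactor_of_mem {j : Fin s} (hj : j ∈ u) :
    cellFactor S u κ τ j = (S j).cell (κ ⟨j, hj⟩) (τ ⟨j, hj⟩) :=
  dif_pos hj

theorem cellFactor_of_notMem {j : Fin s} (hj : j ∉ u) : cellFactor S u κ τ j = X j :=
  dif_neg hj

variable (u)

theorem cellProd_eq_prodSet : cellProd S u κ τ = prodSet (cellFactor S u κ τ) := rfl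

theorem multiHaar_eq_prod (x : Fin s × Fin d → ℝ) :
    multiHaar S u κ τ γ x = ∏ j, multiHaarFactor S u κ τ γ j (component x j) := by
  rw [multiHaar, ← Finset.prod_mul_prod_compl u, ← Finset.prod_coe_sort u]
  congr 1
  · exact Finset.prod_congr rfl fun j _ => by rw [multiHaarFactor_of_mem S κ τ γ j.2]
  · exact Finset.prod_congr rfl fun j hj => by
      rw [multiHaarFactor_of_notMem S κ τ γ (Finset.mem_compl.1 hj)]

theorem measurable_multiHaarFactor (j : Fin s) : Measurable (multiHaarFactor S u κ τ γ j) := by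
  by_cases hj : j ∈ u
  · rw [multiHaarFactor_of_mem S κ τ γ hj]
    exact measurable_haar _ (τ ⟨j, hj⟩).2 _
  · rw [multiHaarFactor_of_notMem S κ τ γ hj]
    exact measurable_one.indicator (S j).measurableSet

theorem measurable_multiHaar : Measurable (multiHaar S u κ τ γ) := by
  simp only [funext (multiHaar_eq_prod S u κ τ γ)]
  refine Finset.measurable_prod _ fun j _ => (measurable_multiHaarFactor S u κ τ γ j).comp ?_
  exact (measurable_pi_apply j).comp (componentEquiv (Fin s) d).measurable

theorem exists_abs_multiHaar_le : ∃ M, ∀ x, |multiHaar S u κ τ γ x| ≤ M := by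
  have hfactor : ∀ j, ∃ M, ∀ x, |multiHaarFactor S u κ τ γ j x| ≤ M := fun j => by
    by_cases hj : j ∈ u
    · rw [multiHaarFactor_of_mem S κ τ γ hj]
      exact ⟨_, abs_haar_le (S j) _⟩
    · rw [multiHaarFactor_of_notMem S κ τ γ hj]
      exact ⟨1, fun x => by by_cases hx : x ∈ X j <;> simp [hx]⟩
  choose M hM using hfactor
  refine ⟨∏ j, M j, fun x => ?_⟩
  rw [multiHaar_eq_prod, Finset.abs_prod]
  exact Finset.prod_le_prod (fun _ _ => abs_nonneg _) fun j _ => hM j _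

theorem setIntegral_multiHaarFactor (hv : ∀ j, volume (X j) = 1) {j : Fin s} (hj : j ∈ u) :
    ∫ x in X j, multiHaarFactor S u κ τ γ j x = 0 := by
  rw [multiHaarFactor_of_mem S κ τ γ hj]
  exact setIntegral_haar (S j) (hv j) (τ ⟨j, hj⟩).2 _

theorem setIntegral_abs_multiHaar (hv : ∀ j, volume (X j) = 1) :
    ∫ x in prodSet X, |multiHaar S u κ τ γ x| =
      ∏ j : u, (2 - 2 / (b : ℝ)) * (b : ℝ) ^ (-((κ j : ℝ) / 2) - 1 / 2) := by
  simp_rw [multiHaar_eq_prod, Finset.abs_prod]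
  rw [setIntegral_prodSet_prod fun j x => |multiHaarFactor S u κ τ γ j x|,
    ← Finset.prod_mul_prod_compl u, Finset.prod_eq_one (s := uᶜ), mul_one, ← Finset.prod_coe_sort u]
  · refine Finset.prod_congr rfl fun j _ => ?_
    rw [multiHaarFactor_of_mem S κ τ γ j.2]
    exact setIntegral_abs_haar (S j) (hv j) (τ j).2 _
  · intro j hj
    rw [multiHaarFactor_of_notMem S κ τ γ (Finset.mem_compl.1 hj),
      setIntegral_congr_fun (g := fun _ => (1 : ℝ)) (S j).measurableSet fun x hx => by simp [hx]]
    simp [measureReal_def, hv j]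

theorem multiHaar_eq_zero_of_notMem_cellProd {x : Fin s × Fin d → ℝ}
    (hx : x ∉ cellProd S u κ τ) : multiHaar S u κ τ γ x = 0 := by
  rw [multiHaar_eq_prod]
  simp only [cellProd_eq_prodSet, prodSet, mem_ofPred_eq, not_forall] at hx
  obtain ⟨j, hxj⟩ := hx
  refine Finset.prod_eq_zero (Finset.mem_univ j) ?_
  by_cases hj : j ∈ u
  · rw [cellFactor_of_mem S κ τ hj] at hxj
    rw [multiHaarFactor_of_mem S κ τ γ hj, haar_eq_zero_of_notMem_cell _ (τ ⟨j, hj⟩).2 _ hxj]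
  · rw [cellFactor_of_notMem S κ τ hj] at hxj
    rw [multiHaarFactor_of_notMem S κ τ γ hj, indicator_of_notMem hxj]

theorem multiHaar_glue {x : Fin s × Fin d → ℝ} (hx : x ∈ prodSet X)
    {y : {j : Fin s // j ∉ u} × Fin d → ℝ} (hy : y ∈ prodSet fun j : {j : Fin s // j ∉ u} => X j) :
    multiHaar S u κ τ γ (glue u x y) = multiHaar S u κ τ γ x := by
  simp only [multiHaar_eq_prod]
  refine Finset.prod_congr rfl fun j _ => ?_
  by_cases hj : j ∈ u
  · rw [component_glue_of_mem hj]
  · rw [multiHaarFactor_of_notMem S κ τ γ hj, component_glue_of_notMem hj,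
      indicator_of_mem (hy ⟨j, hj⟩), indicator_of_mem (hx j), Pi.one_apply, Pi.one_apply]

theorem cellFactor_subset (j : Fin s) : cellFactor S u κ τ j ⊆ X j := by
  by_cases hj : j ∈ u
  · rw [cellFactor_of_mem S κ τ hj]
    exact (S j).cell_subset (τ ⟨j, hj⟩).2
  · rw [cellFactor_of_notMem S κ τ hj]

theorem cellProd_subset : cellProd S u κ τ ⊆ prodSet X :=
  fun _ hx j => cellFactor_subset S u κ τ j (hx j)

theorem cellProd_nonempty (hv : ∀ j, volume (X j) = 1) : (cellProd S u κ τ).Nonempty := by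
  have hfactor : ∀ j, (cellFactor S u κ τ j).Nonempty := fun j => by
    refine nonempty_of_measure_ne_zero (μ := volume) ?_
    by_cases hj : j ∈ u
    · rw [cellFactor_of_mem S κ τ hj, (S j).volume_cell (hv j) (τ ⟨j, hj⟩).2]
      exact ENNReal.inv_ne_zero.2 (ENNReal.pow_ne_top (ENNReal.natCast_ne_top b))
    · rw [cellFactor_of_notMem S κ τ hj, hv j]
      exact one_ne_zero
  choose w hw using hfactor
  exact ⟨fun p => w p.1 p.2, hw⟩

end MultiHaar

/-! ### Rectangular hulls -/

section Hull

variable {ι : Type*} {A B : Set (ι → ℝ)}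

theorem rectHull_eq_Icc (A : Set (ι → ℝ)) :
    rectHull A = Icc (fun l => sInf ((fun x : ι → ℝ => x l) '' A))
      (fun l => sSup ((fun x : ι → ℝ => x l) '' A)) := by
  ext y
  simp only [rectHull, mem_ofPred_eq, mem_Icc, Pi.le_def, forall_and]

theorem subset_rectHull (hA : Bornology.IsBounded A) : A ⊆ rectHull A := fun _ hx l =>
  have hl : Bornology.IsBounded ((fun x : ι → ℝ => x l) '' A) := hA.image_eval l
  ⟨csInf_le hl.bddBelow (mem_image_of_mem _ hx), le_csSup hl.bddAbove (mem_image_of_mem _ hx)⟩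

theorem rectHull_mono (hAB : A ⊆ B) (hA : A.Nonempty) (hB : Bornology.IsBounded B) :
    rectHull A ⊆ rectHull B := fun _ hx l =>
  have hl : Bornology.IsBounded ((fun x : ι → ℝ => x l) '' B) := hB.image_eval l
  ⟨(csInf_le_csInf hl.bddBelow (hA.image _) (image_mono hAB)).trans (hx l).1,
    (hx l).2.trans (csSup_le_csSup hl.bddAbove (hA.image _) (image_mono hAB))⟩

variable {J : Type*} {d : ℕ} {X : J → Set (EuclideanSpace ℝ (Fin d))}

theorem isBounded_image_prodSet {j : J} (hX : Bornology.IsBounded (X j)) (i : Fin d) :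
    Bornology.IsBounded ((fun x : J × Fin d → ℝ => x (j, i)) '' prodSet X) := by
  obtain ⟨M, hM⟩ := hX.exists_norm_le
  refine isBounded_iff_forall_norm_le.2 ⟨M, ?_⟩
  rintro _ ⟨x, hx, rfl⟩
  exact (PiLp.norm_apply_le (component x j) i).trans (hM _ (hx j))

theorem isBounded_prodSet (hX : ∀ j, Bornology.IsBounded (X j)) :
    Bornology.IsBounded (prodSet X) :=
  Bornology.forall_isBounded_image_eval_iff.1 fun p => isBounded_image_prodSet (hX p.1) p.2

theorem sSup_sub_sInf_image_prodSet_le_diam {j : J} (hX : Bornology.IsBounded (X j)) (i : Fin d) :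
    sSup ((fun x : J × Fin d → ℝ => x (j, i)) '' prodSet X) -
      sInf ((fun x : J × Fin d → ℝ => x (j, i)) '' prodSet X) ≤ Metric.diam (X j) := by
  rw [← Real.diam_eq (isBounded_image_prodSet hX i)]
  refine Metric.diam_le_of_forall_dist_le Metric.diam_nonneg ?_
  rintro _ ⟨x, hx, rfl⟩ _ ⟨y, hy, rfl⟩
  rw [dist_eq_norm]
  refine (PiLp.norm_apply_le (component x j - component y j) i).trans ?_
  rw [← dist_eq_norm]
  exact Metric.dist_le_diam_of_mem hX (hx j) (hy j)

end Hull

/-! ### The coefficient bound -/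

theorem prod_mul_rpow_mul_prod_mul_rpow {J : Type*} [Fintype J] (κ : J → ℕ) {b : ℝ} (hb : 0 < b)
    (a C d : ℝ) :
    (∏ j, C * b ^ (-((κ j : ℝ) / d))) * ∏ j, a * b ^ (-((κ j : ℝ) / 2) - 1 / 2) =
      a ^ Fintype.card J *
        b ^ (-(((∑ j, κ j : ℕ) : ℝ) / 2 * (1 + 2 / d)) - (Fintype.card J : ℝ) / 2) *
        C ^ Fintype.card J := by
  have hexponent : -(((∑ j, κ j : ℕ) : ℝ) / 2 * (1 + 2 / d)) - (Fintype.card J : ℝ) / 2 =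
      ∑ j, (-((κ j : ℝ) / d) + (-((κ j : ℝ) / 2) - 1 / 2)) := by
    simp only [Finset.sum_add_distrib, Finset.sum_sub_distrib, Finset.sum_neg_distrib,
      ← Finset.sum_div, Finset.sum_const, Finset.card_univ, nsmul_eq_mul, Nat.cast_sum]
    ring
  simp only [hexponent, Real.rpow_sum_of_pos hb, Real.rpow_add hb, Finset.prod_mul_distrib,
    Finset.prod_const, Finset.card_univ]
  ring

section Bound

variable {s d b : ℕ} {X : Fin s → Set (EuclideanSpace ℝ (Fin d))}
  (S : ∀ j, RecursiveSplit b (X j)) (u : Finset (Fin s)) (κ : u → ℕ)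
  (τ : ∀ j : u, Fin (b ^ κ j)) (γ : u → Fin b) {g e : (Fin s × Fin d → ℝ) → ℝ}

theorem integrableOn_mul_multiHaar (hg : IntegrableOn g (prodSet X)) :
    IntegrableOn (fun x => g x * multiHaar S u κ τ γ x) (prodSet X) := by
  obtain ⟨M, hM⟩ := exists_abs_multiHaar_le S u κ τ γ
  exact hg.mul_bdd (measurable_multiHaar S u κ τ γ).aestronglyMeasurable (.of_forall hM)

theorem lintegral_enorm_multiHaar (hv : ∀ j, volume (X j) = 1) :
    ∫⁻ x in prodSet X, ‖multiHaar S u κ τ γ x‖ₑ =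
      ENNReal.ofReal (∏ j : u, (2 - 2 / (b : ℝ)) * (b : ℝ) ^ (-((κ j : ℝ) / 2) - 1 / 2)) := by
  have := isProbabilityMeasure_prodSet hv
  have hint : IntegrableOn (multiHaar S u κ τ γ) (prodSet X) := by
    simpa only [one_mul] using integrableOn_mul_multiHaar S u κ τ γ (integrable_const (1 : ℝ))
  rw [← setIntegral_abs_multiHaar S u κ τ γ hv]
  exact (ofReal_integral_norm_eq_lintegral_enorm hint).symm

theorem enorm_innerProd_multiHaar_le_mul_lintegral (hv : ∀ j, volume (X j) = 1)
    (hgm : Measurable g) {M : ℝ} (hM : ∀ x, |g x| ≤ M) {z : Fin s × Fin d → ℝ} {B : ℝ≥0∞}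
    (hB : ∀ x ∈ cellProd S u κ τ, ‖mixedDiff z (coordBlock d) u g x‖ₑ ≤ B) :
    ‖innerProd X g (multiHaar S u κ τ γ)‖ₑ ≤ B * ∫⁻ x in prodSet X, ‖multiHaar S u κ τ γ x‖ₑ := by
  have := isProbabilityMeasure_prodSet hv
  have hdiff : innerProd X g (multiHaar S u κ τ γ) =
      ∫ x in prodSet X, mixedDiff z (coordBlock d) u g x * multiHaar S u κ τ γ x := by
    simp only [innerProd, multiHaar_eq_prod]
    refine (setIntegral_mixedDiff_mul_prod hv
      (fun j _ => measurable_multiHaarFactor S u κ τ γ j)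
      (fun j hj => setIntegral_multiHaarFactor S u κ τ γ hv hj) z fun w _ => ?_).symm
    simp only [← multiHaar_eq_prod]
    have hpiecewise : Measurable fun x => (w.biUnion (coordBlock d)).piecewise z x :=
      measurable_pi_lambda _ fun l => by
        by_cases hl : l ∈ w.biUnion (coordBlock d) <;>
          simp only [Finset.piecewise, hl, if_true, if_false] <;> fun_prop
    exact integrableOn_mul_multiHaar S u κ τ γ
      (Integrable.of_bound (hgm.comp hpiecewise).aestronglyMeasurable M
        (.of_forall fun _ => hM _))
  rw [hdiff, ← lintegral_const_mul _ (measurable_multiHaar S u κ τ γ).enorm]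
  refine (enorm_integral_le_lintegral_enorm _).trans (lintegral_mono fun x => ?_)
  rw [enorm_mul]
  by_cases hx : x ∈ cellProd S u κ τ
  · gcongr
    exact hB x hx
  · simp [multiHaar_eq_zero_of_notMem_cellProd S u κ τ γ hx]

theorem HasWeakMixedDerivsOn.enorm_innerProd_multiHaar_le
    (hXb : ∀ j, Bornology.IsBounded (X j)) (hv : ∀ j, volume (X j) = 1)
    (he : HasWeakMixedDerivsOn (rectHull (prodSet X)) e) :
    ‖innerProd X e (multiHaar S u κ τ γ)‖ₑ ≤
      ((∏ j ∈ u, ENNReal.ofReal (Metric.diam (cellFactor S u κ τ j))) *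
        ∑ v ∈ transversals (coordBlock d) u, ⨆ x ∈ rectHull (cellProd S u κ τ),
          ‖mixedPartial (rectHull (prodSet X)) e v x‖ₑ) *
        ∫⁻ x in prodSet X, ‖multiHaar S u κ τ γ x‖ₑ := by
  have hX := isBounded_prodSet hXb
  have hcell := subset_rectHull (hX.subset (cellProd_subset S u κ τ))
  obtain ⟨z, hz⟩ := cellProd_nonempty S u κ τ hv
  have hhull := rectHull_mono (cellProd_subset S u κ τ) ⟨z, hz⟩ hX
  obtain ⟨a, a', hIcc, G, hG, heG⟩ := he
  obtain ⟨M, hM⟩ := hG.bounded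
  have hinner : innerProd X e (multiHaar S u κ τ γ) = innerProd X (G ∅) (multiHaar S u κ τ γ) :=
    setIntegral_congr_fun (measurableSet_prodSet fun j => (S j).measurableSet) fun x hx => by
      rw [heG (subset_rectHull hX hx)]
  rw [hinner]
  refine enorm_innerProd_multiHaar_le_mul_lintegral S u κ τ γ hv (hG.measurable ∅) (hM ∅)
    (z := z) fun x hx => ?_
  have hdiff : EqOn (mixedDiff z (coordBlock d) u (G ∅)) (mixedDiff z (coordBlock d) u e)
      (rectHull (cellProd S u κ τ)) := by
    refine mixedDiff_eqOn (fun w _ y hy => ?_) fun y hy => (heG (hhull hy)).symm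
    rw [rectHull_eq_Icc] at hy hcell ⊢
    exact piecewise_mem_Icc _ (hcell hz) hy
  rw [hdiff (hcell hx)]
  rw [rectHull_eq_Icc (cellProd S u κ τ)] at hhull hcell ⊢
  exact enorm_mixedDiff_coordBlock_le ⟨a, a', hIcc, G, hG, heG⟩ hhull (fun j _ i =>
    ENNReal.ofReal_le_ofReal (sSup_sub_sInf_image_prodSet_le_diam (X := cellFactor S u κ τ)
      ((hXb j).subset (cellFactor_subset S u κ τ j)) i)) (hcell hz) (hcell hx)

theorem prod_diam_cellFactor_mul_lintegral_enorm_multiHaar_le (hb : 0 < b)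
    (hv : ∀ j, volume (X j) = 1) {C : ℝ}
    (hdiam : ∀ j k t, t < b ^ k →
      Metric.diam ((S j).cell k t) ≤ C * (b : ℝ) ^ (-((k : ℝ) / (d : ℝ)))) :
    (∏ j ∈ u, ENNReal.ofReal (Metric.diam (cellFactor S u κ τ j))) *
        ∫⁻ x in prodSet X, ‖multiHaar S u κ τ γ x‖ₑ ≤
      ENNReal.ofReal ((2 - 2 / (b : ℝ)) ^ u.card *
        (b : ℝ) ^ (-(((∑ j, κ j : ℕ) : ℝ) / 2 * (1 + 2 / (d : ℝ))) - (u.card : ℝ) / 2)) *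
        ENNReal.ofReal (C ^ u.card) := by
  have hb' : (1 : ℝ) ≤ b := by exact_mod_cast hb
  have hle : ∀ j : u, Metric.diam (cellFactor S u κ τ j) ≤
      C * (b : ℝ) ^ (-((κ j : ℝ) / (d : ℝ))) := fun j => by
    rw [cellFactor_of_mem S κ τ j.2]
    exact hdiam j _ _ (τ j).2
  have hcoeff : 0 ≤ 2 - 2 / (b : ℝ) := sub_nonneg.2 (div_le_self zero_le_two hb')
  rw [lintegral_enorm_multiHaar S u κ τ γ hv, ← Finset.prod_coe_sort u,
    ← ENNReal.ofReal_mul (mul_nonneg (pow_nonneg hcoeff _) (Real.rpow_nonneg (by positivity) _)),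
    ← Fintype.card_coe u,
    ← prod_mul_rpow_mul_prod_mul_rpow κ (zero_lt_one.trans_le hb'),
    ENNReal.ofReal_mul (Finset.prod_nonneg fun j _ => Metric.diam_nonneg.trans (hle j)),
    ENNReal.ofReal_prod_of_nonneg fun j _ => Metric.diam_nonneg.trans (hle j)]
  gcongr with j
  exact hle j

theorem HasWeakMixedDerivsOn.enorm_innerProd_multiHaar_le_coefficientBound (hd : 0 < d)
    (hb : 0 < b) (hXb : ∀ j, Bornology.IsBounded (X j)) (hv : ∀ j, volume (X j) = 1) {C : ℝ}
    (hdiam : ∀ j k t, t < b ^ k →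
      Metric.diam ((S j).cell k t) ≤ C * (b : ℝ) ^ (-((k : ℝ) / (d : ℝ))))
    (he : HasWeakMixedDerivsOn (rectHull (prodSet X)) e) :
    ‖innerProd X e (multiHaar S u κ τ γ)‖ₑ ≤ coefficientBound S C u κ τ e := by
  refine (he.enorm_innerProd_multiHaar_le S u κ τ γ hXb hv).trans ?_
  rw [mul_right_comm]
  refine (mul_le_mul_left
    (prod_diam_cellFactor_mul_lintegral_enorm_multiHaar_le S u κ τ γ hb hv hdiam) _).trans ?_
  rw [coefficientBound, mul_assoc, Finset.mul_sum]
  gcongr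
  refine le_trans (Finset.sum_le_sum fun v hvu => ?_)
    (Finset.sum_le_sum_of_subset (transversals_coordBlock_subset_touching u))
  have hdim : 1 ≤ (d : ℝ) ^ ((v.card : ℝ) / 2) :=
    Real.one_le_rpow (by exact_mod_cast hd) (by positivity)
  rw [← card_of_mem_transversals (pairwiseDisjoint_coordBlock d _) hvu,
    ENNReal.ofReal_mul (zero_le_one.trans hdim)]
  simp only [← Real.enorm_eq_ofReal_abs]
  gcongr
  exact le_mul_of_one_le_left' (ENNReal.one_le_ofReal.2 hdim)

end Bound

/-! ### ANOVA components -/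

section Anova

variable {s d b : ℕ} {X : Fin s → Set (EuclideanSpace ℝ (Fin d))} {f : (Fin s × Fin d → ℝ) → ℝ}

theorem anova_eq_integralOut (X : Fin s → Set (EuclideanSpace ℝ (Fin d)))
    (f : (Fin s × Fin d → ℝ) → ℝ) (u : Finset (Fin s)) :
    anova X f u = integralOut X u fun x => f x - ∑ v ∈ u.ssubsets, anova X f v x := by
  rw [anova]
  congr 1
  funext x
  rw [← Finset.sum_attach u.ssubsets fun v => anova X f v x]

theorem dependsOn_integralOut (X : Fin s → Set (EuclideanSpace ℝ (Fin d)))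
    (u : Finset (Fin s)) (g : (Fin s × Fin d → ℝ) → ℝ) :
    DependsOn (integralOut X u g) {p | p.1 ∈ u} := fun x x' hxx' => by
  have hglue : glue u x = glue u x' := funext fun y => funext fun p => by
    by_cases hp : p.1 ∈ u
    · simpa only [glue, hp, dif_pos] using hxx' p hp
    · simp only [glue, hp, dif_neg, not_false_eq_true]
  rw [integralOut, integralOut, hglue]

theorem dependsOn_anova (X : Fin s → Set (EuclideanSpace ℝ (Fin d)))
    (f : (Fin s × Fin d → ℝ) → ℝ) (u : Finset (Fin s)) : DependsOn (anova X f u) {p | p.1 ∈ u} :=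
  anova_eq_integralOut X f u ▸ dependsOn_integralOut X u _

theorem integrableOn_anova (hv : ∀ j, volume (X j) = 1) (hf : IntegrableOn f (prodSet X))
    (u : Finset (Fin s)) : IntegrableOn (anova X f u) (prodSet X) := by
  induction u using Finset.strongInduction with
  | H u ih =>
    rw [anova_eq_integralOut]
    exact integrableOn_integralOut hv u
      (hf.sub (integrable_finsetSum _ fun v hvu => ih v (Finset.mem_ssubsets.1 hvu)))

variable (S : ∀ j, RecursiveSplit b (X j)) (u : Finset (Fin s)) (κ : u → ℕ)
  (τ : ∀ j : u, Fin (b ^ κ j)) (γ : u → Fin b)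

theorem innerProd_anova_multiHaar_of_ssubset (hv : ∀ j, volume (X j) = 1) {v : Finset (Fin s)}
    (hvu : v ⊂ u) : innerProd X (anova X f v) (multiHaar S u κ τ γ) = 0 := by
  obtain ⟨j, hju, hjv⟩ := Finset.exists_of_ssubset hvu
  have hindep : DependsOn (anova X f v) {p : Fin s × Fin d | p.1 ≠ j} :=
    (dependsOn_anova X f v).mono fun p hp hpj => hjv (hpj ▸ hp)
  simp only [innerProd, multiHaar_eq_prod]
  exact setIntegral_mul_prod_eq_zero hv (measurable_multiHaarFactor S u κ τ γ j)
    (setIntegral_multiHaarFactor S u κ τ γ hv hju) hindep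

theorem innerProd_anova_multiHaar (hv : ∀ j, volume (X j) = 1)
    (hf : IntegrableOn f (prodSet X)) :
    innerProd X (anova X f u) (multiHaar S u κ τ γ) = innerProd X f (multiHaar S u κ τ γ) := by
  have hanova := integrableOn_anova hv hf
  have hsub : IntegrableOn (fun x => f x - ∑ v ∈ u.ssubsets, anova X f v x) (prodSet X) :=
    hf.sub (integrable_finsetSum _ fun v _ => hanova v)
  rw [innerProd, anova_eq_integralOut,
    setIntegral_integralOut_mul (fun j => (S j).measurableSet) hv
      (fun x hx y hy => multiHaar_glue S u κ τ γ hx hy)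
      (integrableOn_mul_multiHaar S u κ τ γ hsub)]
  have hlower : ∀ v ∈ u.ssubsets, ∫ x in prodSet X, anova X f v x * multiHaar S u κ τ γ x = 0 :=
    fun v hvu => innerProd_anova_multiHaar_of_ssubset S u κ τ γ hv (Finset.mem_ssubsets.1 hvu)
  simp only [sub_mul, Finset.sum_mul]
  rw [integral_sub (integrableOn_mul_multiHaar S u κ τ γ hf)
      (integrable_finsetSum _ fun v _ => integrableOn_mul_multiHaar S u κ τ γ (hanova v)),
    integral_finsetSum _ fun v _ => integrableOn_mul_multiHaar S u κ τ γ (hanova v),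
    Finset.sum_eq_zero hlower, sub_zero, innerProd]

end Anova

/-! ### Smooth functions on boxes -/

section PartialDerivatives

variable {ι : Type*} [DecidableEq ι] {D : Set (ι → ℝ)} {g F F' : (ι → ℝ) → ℝ} {l : ι}

theorem HasPartialWithinAt.hasDerivWithinAt_update
    (h : ∀ x ∈ D, HasPartialWithinAt D F l x (F' x)) {x : ι → ℝ} {r : ℝ} (hr : r ∈ slice D x l) :
    HasDerivWithinAt (fun r => F (Function.update x l r)) (F' (Function.update x l r))
      (slice D x l) r := by
  simpa [HasPartialWithinAt, slice] using h _ hr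

theorem continuous_update_right (x : ι → ℝ) (l : ι) : Continuous fun r => Function.update x l r :=
  continuous_const.update l continuous_id

theorem HasPartialWithinAt.sub_update_eq_integral {x : ι → ℝ} {z : ℝ}
    (hseg : uIcc z (x l) ⊆ slice D x l) (hF' : ContinuousOn F' D)
    (h : ∀ x ∈ D, HasPartialWithinAt D F l x (F' x)) :
    F x - F (Function.update x l z) = ∫ r in z..x l, F' (Function.update x l r) := by
  have hderiv : ∀ r ∈ uIcc z (x l), HasDerivWithinAt (fun r => F (Function.update x l r))
      (F' (Function.update x l r)) (uIcc z (x l)) r := fun r hr =>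
    (hasDerivWithinAt_update h (hseg hr)).mono hseg
  have hcont : ContinuousOn (fun r => F' (Function.update x l r)) (uIcc z (x l)) :=
    hF'.comp (continuous_update_right x l).continuousOn hseg
  rw [intervalIntegral.integral_eq_sub_of_hasDeriv_right
    (fun r hr => (hderiv r hr).continuousWithinAt)
    (fun r hr => ((hderiv r (Ioo_subset_Icc_self hr)).hasDerivAt
      (Icc_mem_nhds hr.1 hr.2)).hasDerivWithinAt) hcont.intervalIntegrable,
    Function.update_eq_self]

theorem measurable_indicator_of_continuousOn {α : Type*} [TopologicalSpace α]
    [MeasurableSpace α] [OpensMeasurableSpace α] {D : Set α} (hD : MeasurableSet D)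
    {F : α → ℝ} (hF : ContinuousOn F D) : Measurable (D.indicator F) := by
  classical
  rw [← Set.piecewise_eq_indicator]
  exact hF.measurable_piecewise continuousOn_const hD

theorem exists_forall_abs_indicator_le {α κ : Type*} [TopologicalSpace α] [Finite κ] {D : Set α}
    (hD : IsCompact D) {F : κ → α → ℝ} (hF : ∀ k, ContinuousOn (F k) D) :
    ∃ M, ∀ k x, |D.indicator (F k) x| ≤ M := by
  cases nonempty_fintype κ
  choose M hM using fun k => hD.exists_bound_of_continuousOn (hF k)
  refine ⟨∑ k, |M k|, fun k x => ?_⟩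
  have hMk : |M k| ≤ ∑ k, |M k| :=
    Finset.single_le_sum (f := fun k => |M k|) (fun _ _ => abs_nonneg _) (Finset.mem_univ k)
  by_cases hx : x ∈ D
  · rw [indicator_of_mem hx]
    exact (hM k x hx).trans ((le_abs_self _).trans hMk)
  · rw [indicator_of_notMem hx, abs_zero]
    exact (abs_nonneg _).trans hMk

theorem SmoothOn.continuousOn (hg : SmoothOn D g) : ContinuousOn g D := by
  obtain ⟨F, hFg, hFc, -⟩ := hg
  exact (hFc ∅).congr hFg.symm

theorem SmoothOn.hasWeakMixedDerivsOn_Icc [Finite ι] {a b : ι → ℝ} (hg : SmoothOn (Icc a b) g) :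
    HasWeakMixedDerivsOn (Icc a b) g := by
  obtain ⟨F, hFg, hFc, hF⟩ := hg
  refine ⟨a, b, rfl, fun P => (Icc a b).indicator (F P), ⟨fun P =>
    measurable_indicator_of_continuousOn measurableSet_Icc (hFc P),
    exists_forall_abs_indicator_le isCompact_Icc hFc, fun P x hx => indicator_of_notMem hx _,
    fun P l hl x hx z hz => ?_⟩, fun x hx => ((indicator_of_mem hx _).trans (hFg hx)).symm⟩
  have hseg : uIcc z (x l) ⊆ slice (Icc a b) x l := fun r hr =>
    (update_mem_Icc_iff hx).2 (uIcc_subset_Icc hz ⟨hx.1 l, hx.2 l⟩ hr)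
  rw [indicator_of_mem hx, indicator_of_mem ((update_mem_Icc_iff hx).2 hz),
    HasPartialWithinAt.sub_update_eq_integral hseg (hFc _) (hF P l hl)]
  exact intervalIntegral.integral_congr fun r hr =>
    (indicator_of_mem (s := Icc a b) (hseg hr) _).symm

theorem InCm.smoothOn [Fintype ι] {m : ℕ} (hm : Fintype.card ι ≤ m) (hg : InCm D m g) :
    SmoothOn D g := by
  obtain ⟨G, hGg, hGc, hG⟩ := hg
  let χ : Finset ι → ι → ℕ := fun v i => if i ∈ v then 1 else 0
  have hsum : ∀ v, ∑ i, χ v i = v.card := fun v => by simp [χ]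
  have hempty : χ ∅ = 0 := funext fun i => by simp [χ]
  have hinsert : ∀ v, ∀ l ∉ v, χ v + Pi.single l 1 = χ (insert l v) := fun v l hl => by
    funext i
    obtain rfl | hi := eq_or_ne i l
    · simp [χ, hl]
    · simp [χ, hi]
  refine ⟨fun v => G (χ v), fun x hx => (congrFun (congrArg G hempty) x).trans (hGg hx),
    fun v => hGc _ ((hsum v).trans_le ((Finset.card_le_univ v).trans hm)), fun v l hl x hx => ?_⟩
  simp only [← hinsert v l hl]
  exact hG _ l ((hsum v).trans_lt ((Finset.card_lt_univ_of_notMem hl).trans_le hm)) x hx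

theorem IsWhitneyExtension.eqOn [Fintype ι] {m : ℕ} {e : (ι → ℝ) → ℝ}
    (he : IsWhitneyExtension D m g e) (hD : D ⊆ rectHull D) : EqOn e g D := by
  obtain ⟨⟨G, E, hG, hE, hGE⟩, -⟩ := he
  intro x hx
  rw [← hE.1 (hD hx), hGE 0 (by simp) hx, hG.1 hx]

theorem IsWhitneyExtension.hasWeakMixedDerivsOn [Fintype ι] {m : ℕ} {e : (ι → ℝ) → ℝ}
    (he : IsWhitneyExtension D m g e) (hm : Fintype.card ι ≤ m) :
    HasWeakMixedDerivsOn (rectHull D) e := by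
  obtain ⟨⟨G, E, -, hE, -⟩, -⟩ := he
  have hsmooth : SmoothOn (rectHull D) e := InCm.smoothOn hm ⟨E, hE⟩
  rw [rectHull_eq_Icc] at hsmooth ⊢
  exact hsmooth.hasWeakMixedDerivsOn_Icc

end PartialDerivatives

section Compactness

variable {s d : ℕ} {X : Fin s → Set (EuclideanSpace ℝ (Fin d))}

theorem isCompact_prodSet (hXb : ∀ j, Bornology.IsBounded (X j)) (hX : IsClosed (prodSet X)) :
    IsCompact (prodSet X) :=
  Metric.isCompact_of_isClosed_isBounded hX (isBounded_prodSet hXb)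

theorem isClosed_prodSet (hX : ∀ j, IsClosed (X j)) : IsClosed (prodSet X) := by
  simp only [prodSet, ofPred_forall]
  exact isClosed_iInter fun j => (hX j).preimage
    ((PiLp.continuous_toLp 2 _).comp (continuous_pi fun i => continuous_apply (j, i)))

end Compactness

/-! ### Smoothness of the ANOVA components -/

section SmoothOn

variable {ι : Type*} [DecidableEq ι] {D : Set (ι → ℝ)} {g h : (ι → ℝ) → ℝ}

theorem SmoothOn.sub (hg : SmoothOn D g) (hh : SmoothOn D h) : SmoothOn D fun x => g x - h x := by
  obtain ⟨F, hFg, hFc, hF⟩ := hg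
  obtain ⟨F', hFh, hFc', hF'⟩ := hh
  exact ⟨fun v x => F v x - F' v x, fun x hx => by simp only [hFg hx, hFh hx],
    fun v => (hFc v).sub (hFc' v), fun v l hl x hx => (hF v l hl x hx).sub (hF' v l hl x hx)⟩

theorem SmoothOn.sum {κ : Type*} (T : Finset κ) {g : κ → (ι → ℝ) → ℝ}
    (hg : ∀ k ∈ T, SmoothOn D (g k)) : SmoothOn D fun x => ∑ k ∈ T, g k x := by
  choose! F hFg hFc hF using hg
  exact ⟨fun v x => ∑ k ∈ T, F k v x, fun x hx => Finset.sum_congr rfl fun k hk => hFg k hk hx,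
    fun v => continuousOn_finsetSum _ fun k hk => hFc k hk v,
    fun v l hl x hx => HasDerivWithinAt.fun_sum fun k hk => hF k hk v l hl x hx⟩

theorem hasPartialWithinAt_zero_of_dependsOn {T : Set ι} (hg : DependsOn g T) {l : ι} (hl : l ∉ T)
    (x : ι → ℝ) : HasPartialWithinAt D g l x 0 := by
  have hconst : (fun r => g (Function.update x l r)) = fun _ => g x :=
    funext fun r => hg fun m hm => Function.update_of_ne (ne_of_mem_of_not_mem hm hl) _ _
  rw [HasPartialWithinAt, hconst]
  exact hasDerivWithinAt_const _ _ _

end SmoothOn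

section SobolExtensible

variable {ι : Type*} [DecidableEq ι] {D : Set (ι → ℝ)} {c : ι → ℝ}

theorem IsSobolExtensible.update_mem (hD : IsSobolExtensible D c) {x : ι → ℝ} (hx : x ∈ D) {l : ι}
    {r : ℝ} (hr : r ∈ uIcc (c l) (x l)) : Function.update x l r ∈ D :=
  hD.box_subset x hx ((update_mem_Icc_iff ⟨inf_le_right, le_sup_right⟩).2 hr)

theorem IsSobolExtensible.convex_slice (hD : IsSobolExtensible D c) (x : ι → ℝ) (l : ι) :
    Convex ℝ (slice D x l) := by
  have huIcc : ∀ r ∈ slice D x l, uIcc (c l) r ⊆ slice D x l := fun r hr t ht => by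
    simpa [slice] using hD.update_mem (l := l) (r := t) hr (by simpa using ht)
  refine convex_iff_ordConnected.2 ⟨fun r hr r' hr' t ht => ?_⟩
  rcases le_total t (c l) with htc | htc
  · exact huIcc r hr ⟨inf_le_right.trans ht.1, htc.trans le_sup_left⟩
  · exact huIcc r' hr' ⟨inf_le_left.trans htc, ht.2.trans le_sup_right⟩

end SobolExtensible

theorem hasDerivWithinAt_integral_of_bounded {α : Type*} [MeasurableSpace α] {μ : Measure α}
    [IsFiniteMeasure μ] {I : Set ℝ} (hI : Convex ℝ I) {φ φ' : ℝ → α → ℝ} {r₀ : ℝ}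
    (hr₀ : r₀ ∈ I) (hφ : ∀ r ∈ I, Integrable (φ r) μ) (M : ℝ)
    (hderiv : ∀ᵐ y ∂μ, ∀ r ∈ I,
      HasDerivWithinAt (fun r => φ r y) (φ' r y) I r ∧ |φ' r y| ≤ M) :
    HasDerivWithinAt (fun r => ∫ y, φ r y ∂μ) (∫ y, φ' r₀ y ∂μ) I r₀ := by
  rw [hasDerivWithinAt_iff_tendsto_slope]
  have hmem : ∀ᶠ r in 𝓝[I \ {r₀}] r₀, r ∈ I \ {r₀} := self_mem_nhdsWithin
  have htendsto : Filter.Tendsto (fun r => ∫ y, slope (fun r => φ r y) r₀ r ∂μ) (𝓝[I \ {r₀}] r₀)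
      (𝓝 (∫ y, φ' r₀ y ∂μ)) := by
    refine tendsto_integral_filter_of_dominated_convergence (fun _ => M) ?_ ?_
      (integrable_const M) ?_
    · filter_upwards [hmem] with r hr
      simp only [slope_def_field]
      exact (((hφ r hr.1).sub (hφ r₀ hr₀)).div_const _).aestronglyMeasurable
    · filter_upwards [hmem] with r hr
      filter_upwards [hderiv] with y hy
      rw [slope_def_field, norm_div, div_le_iff₀ (norm_pos_iff.2 (sub_ne_zero.2 hr.2))]
      exact hI.norm_image_sub_le_of_norm_hasDerivWithin_le
        (fun r hr => (hy r hr).1) (fun r hr => (hy r hr).2) hr₀ hr.1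
    · filter_upwards [hderiv] with y hy
      exact hasDerivWithinAt_iff_tendsto_slope.1 (hy r₀ hr₀).1
  refine htendsto.congr' ?_
  filter_upwards [hmem] with r hr
  simp only [slope_def_field]
  rw [integral_div, integral_sub (hφ r hr.1) (hφ r₀ hr₀)]

section IntegralOut

variable {s d : ℕ} {X : Fin s → Set (EuclideanSpace ℝ (Fin d))} {u : Finset (Fin s)}
  {F F' : (Fin s × Fin d → ℝ) → ℝ} {x : Fin s × Fin d → ℝ}

theorem glue_mem_prodSet (hx : x ∈ prodSet X) {y : {j : Fin s // j ∉ u} × Fin d → ℝ}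
    (hy : y ∈ prodSet fun j : {j : Fin s // j ∉ u} => X j.1) : glue u x y ∈ prodSet X := fun j => by
  by_cases hj : j ∈ u
  · exact component_glue_of_mem hj x y ▸ hx j
  · exact component_glue_of_notMem hj x y ▸ hy ⟨j, hj⟩

theorem glue_update {l : Fin s × Fin d} (hl : l.1 ∈ u) (x : Fin s × Fin d → ℝ) (r : ℝ)
    (y : {j : Fin s // j ∉ u} × Fin d → ℝ) :
    glue u (Function.update x l r) y = Function.update (glue u x y) l r := by
  funext p
  by_cases hp : p = l
  · subst hp; simp [glue, hl]
  · by_cases hpu : p.1 ∈ u <;> simp [glue, hp, hpu]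

theorem slice_prodSet_glue (hx : x ∈ prodSet X) {y : {j : Fin s // j ∉ u} × Fin d → ℝ}
    (hy : y ∈ prodSet fun j : {j : Fin s // j ∉ u} => X j.1) {l : Fin s × Fin d} (hl : l.1 ∈ u) :
    slice (prodSet X) (glue u x y) l = slice (prodSet X) x l := by
  ext r
  simp only [slice, mem_ofPred_eq, ← glue_update hl]
  refine ⟨fun hr j => ?_, fun hr => glue_mem_prodSet hr hy⟩
  by_cases hj : j ∈ u
  · exact component_glue_of_mem hj (Function.update x l r) y ▸ hr j
  · have hcomponent : component (Function.update x l r) j = component x j := by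
      ext i
      exact Function.update_of_ne (fun hil => hj (by rwa [← hil] at hl)) _ _
    exact hcomponent ▸ hx j

theorem continuous_glue (u : Finset (Fin s)) :
    Continuous fun q : (Fin s × Fin d → ℝ) × ({j : Fin s // j ∉ u} × Fin d → ℝ) =>
      glue u q.1 q.2 := by
  refine continuous_pi fun p => ?_
  by_cases hp : p.1 ∈ u
  · simp only [glue, hp, dif_pos]
    fun_prop
  · simp only [glue, hp, dif_neg, not_false_eq_true]
    fun_prop

theorem integrableOn_comp_glue (hX : ∀ j, MeasurableSet (X j)) (hv : ∀ j, volume (X j) = 1)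
    (hK : IsCompact (prodSet X)) (hF : ContinuousOn F (prodSet X)) (hx : x ∈ prodSet X) :
    IntegrableOn (fun y => F (glue u x y)) (prodSet fun j : {j : Fin s // j ∉ u} => X j.1) := by
  have hY : MeasurableSet (prodSet fun j : {j : Fin s // j ∉ u} => X j.1) :=
    measurableSet_prodSet fun j => hX j
  have := isProbabilityMeasure_prodSet fun j : {j : Fin s // j ∉ u} => hv j
  obtain ⟨M, hM⟩ := hK.exists_bound_of_continuousOn hF
  refine Integrable.of_bound (C := M) ((hF.comp
    ((continuous_glue u).comp (Continuous.prodMk_right x)).continuousOn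
    fun y hy => glue_mem_prodSet hx hy).aestronglyMeasurable hY) ?_
  filter_upwards [ae_restrict_mem hY] with y hy using hM _ (glue_mem_prodSet hx hy)

theorem continuousOn_integralOut (hX : ∀ j, MeasurableSet (X j)) (hv : ∀ j, volume (X j) = 1)
    (hK : IsCompact (prodSet X)) (hF : ContinuousOn F (prodSet X)) :
    ContinuousOn (integralOut X u F) (prodSet X) := by
  have hY : MeasurableSet (prodSet fun j : {j : Fin s // j ∉ u} => X j.1) :=
    measurableSet_prodSet fun j => hX j
  have := isProbabilityMeasure_prodSet fun j : {j : Fin s // j ∉ u} => hv j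
  obtain ⟨M, hM⟩ := hK.exists_bound_of_continuousOn hF
  refine continuousOn_of_dominated (bound := fun _ => M)
    (fun x hx => (integrableOn_comp_glue hX hv hK hF hx).aestronglyMeasurable) (fun x hx => ?_)
    (integrable_const M) ?_
  · filter_upwards [ae_restrict_mem hY] with y hy using hM _ (glue_mem_prodSet hx hy)
  · filter_upwards [ae_restrict_mem hY] with y hy
    exact hF.comp ((continuous_glue u).comp (Continuous.prodMk_left y)).continuousOn
      fun x hx => glue_mem_prodSet hx hy

theorem hasPartialWithinAt_integralOut (hX : ∀ j, MeasurableSet (X j))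
    (hv : ∀ j, volume (X j) = 1) (hK : IsCompact (prodSet X)) {l : Fin s × Fin d}
    (hconvex : Convex ℝ (slice (prodSet X) x l)) (hl : l.1 ∈ u) (hF : ContinuousOn F (prodSet X))
    (hF' : ContinuousOn F' (prodSet X))
    (h : ∀ x ∈ prodSet X, HasPartialWithinAt (prodSet X) F l x (F' x)) (hx : x ∈ prodSet X) :
    HasPartialWithinAt (prodSet X) (integralOut X u F) l x (integralOut X u F' x) := by
  have hY : MeasurableSet (prodSet fun j : {j : Fin s // j ∉ u} => X j.1) :=
    measurableSet_prodSet fun j => hX j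
  have := isProbabilityMeasure_prodSet fun j : {j : Fin s // j ∉ u} => hv j
  obtain ⟨M, hM⟩ := hK.exists_bound_of_continuousOn hF'
  have hderiv := hasDerivWithinAt_integral_of_bounded
    (μ := volume.restrict (prodSet fun j : {j : Fin s // j ∉ u} => X j.1))
    (φ := fun r y => F (glue u (Function.update x l r) y))
    (φ' := fun r y => F' (glue u (Function.update x l r) y)) (r₀ := x l) hconvex
    (by simpa [slice] using hx) (fun r hr => integrableOn_comp_glue hX hv hK hF hr) M (by
      filter_upwards [ae_restrict_mem hY] with y hy r hr
      refine ⟨?_, hM _ (glue_mem_prodSet hr hy)⟩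
      rw [← slice_prodSet_glue hx hy hl] at hr ⊢
      simp only [glue_update hl]
      exact HasPartialWithinAt.hasDerivWithinAt_update h hr)
  simpa only [HasPartialWithinAt, integralOut, Function.update_eq_self] using hderiv

theorem smoothOn_integralOut (hX : ∀ j, MeasurableSet (X j)) (hv : ∀ j, volume (X j) = 1)
    (hK : IsCompact (prodSet X))
    (hconvex : ∀ x l, Convex ℝ (slice (prodSet X) x l)) (hF : SmoothOn (prodSet X) F)
    (u : Finset (Fin s)) : SmoothOn (prodSet X) (integralOut X u F) := by
  classical
  obtain ⟨G, hGF, hGc, hG⟩ := hF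
  refine ⟨fun v => if ∀ p ∈ v, p.1 ∈ u then integralOut X u (G v) else 0, fun x hx => ?_,
    fun v => ?_, fun v l hl x hx => ?_⟩
  · simp only [Finset.notMem_empty, false_imp_iff, implies_true, if_true]
    exact setIntegral_congr_fun (measurableSet_prodSet fun j => hX j)
      fun y hy => hGF (glue_mem_prodSet hx hy)
  · dsimp only
    split_ifs
    · exact continuousOn_integralOut hX hv hK (hGc v)
    · exact continuousOn_const
  · simp only [Finset.forall_mem_insert]
    by_cases hvu : ∀ p ∈ v, p.1 ∈ u
    · by_cases hlu : l.1 ∈ u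
      · simpa only [if_pos hvu, if_pos (And.intro hlu hvu)] using
          hasPartialWithinAt_integralOut hX hv hK (hconvex x l) hlu (hGc v) (hGc _) (hG v l hl) hx
      · simpa only [if_pos hvu, if_neg fun h : l.1 ∈ u ∧ _ => hlu h.1,
          Pi.zero_apply] using
          hasPartialWithinAt_zero_of_dependsOn (dependsOn_integralOut X u (G v)) hlu x
    · simpa only [if_neg hvu, if_neg fun h : l.1 ∈ u ∧ _ => hvu h.2, Pi.zero_apply] using
        hasPartialWithinAt_zero_of_dependsOn (show DependsOn 0 ∅ from dependsOn_const 0)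
          (notMem_empty l) x

theorem smoothOn_anova (hX : ∀ j, MeasurableSet (X j)) (hv : ∀ j, volume (X j) = 1)
    (hK : IsCompact (prodSet X)) (hconvex : ∀ x l, Convex ℝ (slice (prodSet X) x l))
    (hF : SmoothOn (prodSet X) F) (u : Finset (Fin s)) : SmoothOn (prodSet X) (anova X F u) := by
  induction u using Finset.strongInduction with
  | H u ih =>
    rw [anova_eq_integralOut]
    exact smoothOn_integralOut hX hv hK hconvex
      (hF.sub (SmoothOn.sum _ fun v hvu => ih v (Finset.mem_ssubsets.1 hvu))) u

end IntegralOut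

/-! ### Iterated primitives -/

section IteratedPrimitive

theorem uIcc_restrict {ι : Type*} (w : Finset ι) (c x : ι → ℝ) :
    uIcc (fun l : w => c l) (fun l : w => x l) = univ.pi fun l : w => uIcc (c l) (x l) :=
  (pi_univ_uIcc _ _).symm

variable {ι : Type*} [DecidableEq ι]

/-- The iterated primitive `∫_{[c_w, x_w]} h(x_{-w} : y_w) dy_w` of `h` with respect to the
coordinates in `w`, vanishing where `x_l = c_l` for some `l ∈ w`. -/
noncomputable def iteratedPrimitive (c : ι → ℝ) (w : Finset ι) (h : (ι → ℝ) → ℝ) (x : ι → ℝ) : ℝ :=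
  signedBoxIntegral w c x fun y => h (hybrid x w y)

variable {c x : ι → ℝ} {w : Finset ι} {l : ι} {h : (ι → ℝ) → ℝ} {M : ℝ}

theorem hybrid_eq_updateFinset (c : ι → ℝ) (w : Finset ι) (y : w → ℝ) :
    hybrid c w y = Function.updateFinset c w y :=
  rfl

theorem measurable_hybrid (w : Finset ι) :
    Measurable fun q : (ι → ℝ) × (w → ℝ) => hybrid q.1 w q.2 :=
  measurable_updateFinset'

theorem measurable_iteratedPrimitive (c : ι → ℝ) (w : Finset ι) (hh : Measurable h) :
    Measurable (iteratedPrimitive c w h) := by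
  let A : Set ((ι → ℝ) × (w → ℝ)) := {q | ∀ l : w, q.2 l ∈ uIcc (c l) (q.1 l)}
  have hA : MeasurableSet A := by
    simp only [A, uIcc, mem_Icc, ofPred_forall, ofPred_and]
    exact MeasurableSet.iInter fun l =>
      (measurableSet_le (by fun_prop) (by fun_prop)).inter
        (measurableSet_le (by fun_prop) (by fun_prop))
  have hindicator : ∀ x : ι → ℝ,
      ∫ y in uIcc (fun l : w => c l) (fun l : w => x l), h (hybrid x w y) =
        ∫ y, A.indicator (fun q => h (hybrid q.1 w q.2)) (x, y) := fun x => by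
    have hbox : MeasurableSet (uIcc (fun l : w => c l) fun l : w => x l) := measurableSet_Icc
    rw [← integral_indicator hbox]
    refine integral_congr_ae (Filter.Eventually.of_forall fun y => ?_)
    have hmem : (x, y) ∈ A ↔ y ∈ uIcc (fun l : w => c l) fun l : w => x l := by
      rw [uIcc_restrict, mem_univ_pi]
      rfl
    by_cases hy : y ∈ uIcc (fun l : w => c l) fun l : w => x l
    · simp only [indicator_of_mem hy, indicator_of_mem (hmem.2 hy)]
    · simp only [indicator_of_notMem hy, indicator_of_notMem (mt hmem.1 hy)]
  have hjoint : StronglyMeasurable (A.indicator fun q => h (hybrid q.1 w q.2)) :=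
    ((hh.comp (measurable_hybrid w)).indicator hA).stronglyMeasurable
  unfold iteratedPrimitive signedBoxIntegral
  simp only [hindicator]
  exact (Finset.measurable_prod _ fun l _ => Measurable.ite
    (measurableSet_lt (measurable_pi_apply l) measurable_const) measurable_const
    measurable_const).mul (hjoint.integral_prod_right' (ν := volume)).measurable

theorem abs_iteratedPrimitive_le (hM : ∀ x, |h x| ≤ M) (c : ι → ℝ) (w : Finset ι) (x : ι → ℝ) :
    |iteratedPrimitive c w h x| ≤ M * ∏ l ∈ w, |x l - c l| := by
  have hsign : |∏ l ∈ w, if x l < c l then (-1 : ℝ) else 1| = 1 := by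
    rw [Finset.abs_prod]
    exact Finset.prod_eq_one fun l _ => by split_ifs <;> simp
  have hvolume : volume.real (uIcc (fun l : w => c l) (fun l : w => x l)) =
      ∏ l ∈ w, |x l - c l| := by
    rw [uIcc_restrict, measureReal_def, volume_pi_pi, ENNReal.toReal_prod,
      ← Finset.prod_coe_sort w]
    simp only [Real.volume_interval, ENNReal.toReal_ofReal (abs_nonneg _)]
  rw [iteratedPrimitive, signedBoxIntegral, abs_mul, hsign, one_mul, ← hvolume]
  exact norm_setIntegral_le_of_norm_le_const (f := fun y => h (hybrid x w y)) (C := M)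
    isCompact_Icc.measure_lt_top fun y _ => hM _

theorem iteratedPrimitive_eq_zero (hM : ∀ x, |h x| ≤ M) (hl : l ∈ w) (hxl : x l = c l) :
    iteratedPrimitive c w h x = 0 := by
  have hle := abs_iteratedPrimitive_le hM c w x
  rwa [Finset.prod_eq_zero hl (by rw [hxl, sub_self, abs_zero]), mul_zero, abs_nonpos_iff] at hle

theorem iteratedPrimitive_update (hl : l ∉ w)
    (hh : ∀ x r, h (Function.update x l r) = h x) (c x : ι → ℝ) (r : ℝ) :
    iteratedPrimitive c w h (Function.update x l r) = iteratedPrimitive c w h x := by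
  have hne : ∀ m ∈ w, Function.update x l r m = x m := fun m hm =>
    Function.update_of_ne (ne_of_mem_of_not_mem hm hl) _ _
  have hhybrid : ∀ y : w → ℝ,
      hybrid (Function.update x l r) w y = Function.update (hybrid x w y) l r := fun y => by
    funext m
    obtain rfl | hml := eq_or_ne m l
    · simp [hybrid, hl]
    · by_cases hm : m ∈ w <;> simp [hybrid, hm, hml]
  simp only [iteratedPrimitive, signedBoxIntegral, hhybrid, hh, hne _ (Finset.coe_mem _)]
  rw [Finset.prod_congr rfl fun m hm => by rw [hne m hm]]

theorem iteratedPrimitive_empty (c : ι → ℝ) (h : (ι → ℝ) → ℝ) (x : ι → ℝ) :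
    iteratedPrimitive c ∅ h x = h x := by
  have hhybrid : ∀ y, hybrid x ∅ y = x := fun y => funext fun m => by simp [hybrid]
  simp [iteratedPrimitive, signedBoxIntegral, hhybrid, measureReal_def]

theorem iteratedPrimitive_singleton (c : ι → ℝ) (l : ι) (h : (ι → ℝ) → ℝ) (x : ι → ℝ) :
    iteratedPrimitive c {l} h x = ∫ r in c l..x l, h (Function.update x l r) := by
  have hhybrid : ∀ y : ({l} : Finset ι) → ℝ, hybrid x {l} y = Function.update x l (y default) :=
    fun y => Function.updateFinset_singleton
  have hpreimage : (uIcc (fun m : ({l} : Finset ι) => c m) fun m => x m) =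
      MeasurableEquiv.funUnique ({l} : Finset ι) ℝ ⁻¹' uIcc (c l) (x l) := by
    ext y
    rw [uIcc_restrict, mem_univ_pi]
    exact ⟨fun hy => hy default, fun hy => Unique.forall_iff.2 hy⟩
  have hintegral : ∫ y in MeasurableEquiv.funUnique ({l} : Finset ι) ℝ ⁻¹' uIcc (c l) (x l),
      h (Function.update x l (y default)) =
        ∫ r in uIcc (c l) (x l), h (Function.update x l r) :=
    (volume_preserving_funUnique ({l} : Finset ι) ℝ).setIntegral_preimage_emb
      (MeasurableEquiv.measurableEmbedding _) (fun r => h (Function.update x l r)) _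
  rw [iteratedPrimitive, signedBoxIntegral, Finset.prod_singleton, hpreimage]
  simp only [hhybrid]
  rw [hintegral, intervalIntegral.intervalIntegral_eq_integral_uIoc, smul_eq_mul, uIoc, uIcc,
    integral_Icc_eq_integral_Ioc]
  simp only [← not_lt, ite_not]

theorem preimage_piFinsetUnion_uIcc {s t : Finset ι} (hst : Disjoint s t) (c x : ι → ℝ) :
    MeasurableEquiv.piFinsetUnion (fun _ : ι => ℝ) hst ⁻¹'
        (uIcc (fun m : ↥(s ∪ t) => c m) fun m => x m) =
      (uIcc (fun m : s => c m) fun m => x m) ×ˢ uIcc (fun m : t => c m) fun m => x m := by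
  ext q
  have hleft : ∀ (m : s) (hm : m.1 ∈ s ∪ t),
      MeasurableEquiv.piFinsetUnion (fun _ : ι => ℝ) hst q ⟨m, hm⟩ = q.1 m :=
    fun m hm => Equiv.piFinsetUnion_left (fun _ : ι => ℝ) hst m.2 hm
  have hright : ∀ (m : t) (hm : m.1 ∈ s ∪ t),
      MeasurableEquiv.piFinsetUnion (fun _ : ι => ℝ) hst q ⟨m, hm⟩ = q.2 m :=
    fun m hm => Equiv.piFinsetUnion_right (fun _ : ι => ℝ) hst m.2 hm
  simp only [uIcc_restrict, mem_preimage, mem_univ_pi, mem_prod]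
  refine ⟨fun hq => ⟨fun m => ?_, fun m => ?_⟩, fun hq ⟨m, hm⟩ => ?_⟩
  · simpa only [hleft] using hq ⟨m, Finset.mem_union_left _ m.2⟩
  · simpa only [hright] using hq ⟨m, Finset.mem_union_right _ m.2⟩
  · obtain hms | hmt := Finset.mem_union.1 hm
    · simpa only [hleft ⟨m, hms⟩] using hq.1 ⟨m, hms⟩
    · simpa only [hright ⟨m, hmt⟩] using hq.2 ⟨m, hmt⟩

theorem iteratedPrimitive_union {s t : Finset ι} (hst : Disjoint s t) (hh : Measurable h)
    (hM : ∀ x, |h x| ≤ M) (c x : ι → ℝ) :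
    iteratedPrimitive c (s ∪ t) h x = iteratedPrimitive c s (iteratedPrimitive c t h) x := by
  have hhybrid : ∀ q, hybrid x (s ∪ t) (MeasurableEquiv.piFinsetUnion (fun _ : ι => ℝ) hst q) =
      hybrid (hybrid x s q.1) t q.2 := fun q => by
    simp only [hybrid_eq_updateFinset, Function.updateFinset_updateFinset hst]
    rfl
  have hoff : ∀ (y : s → ℝ), ∀ m ∈ t, hybrid x s y m = x m := fun y m hm =>
    dif_neg (Finset.disjoint_right.1 hst hm)
  have hmeasurable : Measurable fun q : (s → ℝ) × (t → ℝ) => h (hybrid (hybrid x s q.1) t q.2) :=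
    hh.comp ((measurable_hybrid t).comp
      (((measurable_hybrid s).comp (measurable_const.prodMk measurable_fst)).prodMk measurable_snd))
  have hintegral : ∫ y in uIcc (fun m : ↥(s ∪ t) => c m) fun m => x m, h (hybrid x (s ∪ t) y) =
      ∫ y in uIcc (fun m : s => c m) fun m => x m, ∫ z in uIcc (fun m : t => c m) fun m => x m,
        h (hybrid (hybrid x s y) t z) := by
    rw [← (volume_preserving_piFinsetUnion (fun _ : ι => ℝ) hst).setIntegral_preimage_emb
      (MeasurableEquiv.measurableEmbedding _), preimage_piFinsetUnion_uIcc]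
    simp only [hhybrid]
    exact setIntegral_prod _ (Measure.integrableOn_of_bounded
      (isCompact_Icc.prod isCompact_Icc).measure_lt_top.ne
      hmeasurable.aestronglyMeasurable (Filter.Eventually.of_forall fun q => hM _))
  simp only [iteratedPrimitive, signedBoxIntegral]
  rw [hintegral, Finset.prod_union hst, mul_assoc, ← integral_const_mul]
  congr 1
  refine integral_congr_ae (Filter.Eventually.of_forall fun y => ?_)
  simp only [hoff y _ (Finset.coe_mem _)]
  exact congrArg (· * _) (Finset.prod_congr rfl fun m hm => by rw [hoff y m hm])

theorem iteratedPrimitive_insert (hl : l ∉ w) (hh : Measurable h) (hM : ∀ x, |h x| ≤ M)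
    (c x : ι → ℝ) : iteratedPrimitive c (insert l w) h x =
      ∫ r in c l..x l, iteratedPrimitive c w h (Function.update x l r) := by
  rw [Finset.insert_eq, iteratedPrimitive_union (Finset.disjoint_singleton_left.2 hl) hh hM,
    iteratedPrimitive_singleton]

end IteratedPrimitive

/-! ### The Sobol' extension -/

section Sobol

variable {ι : Type*}

/-- Bounded measurable functions `H w`, each depending only on the coordinates in `w`. They stand
for the mixed derivatives `∂^w g` at the hybrid points `c_{-w} : x_w`, as functions of `x`. -/
structure AnchoredFamily (H : Finset ι → (ι → ℝ) → ℝ) : Prop where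
  measurable : ∀ w, Measurable (H w)
  bounded : ∃ M, ∀ w x, |H w x| ≤ M
  dependsOn : ∀ w, DependsOn (H w) w

variable [DecidableEq ι] {c x : ι → ℝ} {P w : Finset ι} {l : ι} {H : Finset ι → (ι → ℝ) → ℝ}
  {M : ℝ}

theorem intervalIntegrable_iteratedPrimitive_update {h : (ι → ℝ) → ℝ} (hh : Measurable h)
    (hM : ∀ x, |h x| ≤ M) (hl : l ∉ w) (c x : ι → ℝ) (p q : ℝ) :
    IntervalIntegrable (fun r => iteratedPrimitive c w h (Function.update x l r)) volume p q := by
  have hne : ∀ m ∈ w, ∀ r, Function.update x l r m = x m := fun m hm _ =>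
    Function.update_of_ne (ne_of_mem_of_not_mem hm hl) _ _
  refine (intervalIntegrable_const (c := M * ∏ m ∈ w, |x m - c m|)).mono_fun
    ((measurable_iteratedPrimitive c w hh).comp (measurable_update x)).aestronglyMeasurable
    (Filter.Eventually.of_forall fun r => ?_)
  have hle := abs_iteratedPrimitive_le hM c w (Function.update x l r)
  rw [Finset.prod_congr rfl fun m hm => congrArg (|· - c m|) (hne m hm r)] at hle
  exact hle.trans (le_abs_self _)

variable [Fintype ι]

/-- The formal mixed derivative `∂^P` of the Sobol' extension
`∑_w ∫_{[c_w, x_w]} H_w(y_w) dy_w`. -/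
noncomputable def sobolSum (c : ι → ℝ) (H : Finset ι → (ι → ℝ) → ℝ) (P : Finset ι) (x : ι → ℝ) :
    ℝ :=
  ∑ w ∈ Pᶜ.powerset, iteratedPrimitive c w (H (w ∪ P)) x

theorem AnchoredFamily.sobolSum_eq_add (hH : AnchoredFamily H) (hl : l ∉ P) (c x : ι → ℝ) :
    sobolSum c H P x = ∑ w ∈ (insert l P)ᶜ.powerset, iteratedPrimitive c w (H (w ∪ P)) x +
      ∫ r in c l..x l, sobolSum c H (insert l P) (Function.update x l r) := by
  obtain ⟨M, hM⟩ := hH.bounded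
  have hlw : ∀ w ∈ (insert l P)ᶜ.powerset, l ∉ w := fun w hw h => by
    simpa using Finset.mem_powerset.1 hw h
  have hcompl : Pᶜ = insert l (insert l P)ᶜ := by
    rw [← Finset.compl_erase, Finset.erase_insert hl]
  simp only [sobolSum]
  rw [intervalIntegral.integral_finsetSum fun w hw =>
      intervalIntegrable_iteratedPrimitive_update (hH.measurable _) (hM _) (hlw w hw) c x _ _,
    hcompl, Finset.sum_powerset_insert (by simp)]
  refine congrArg _ (Finset.sum_congr rfl fun w hw => ?_)
  rw [iteratedPrimitive_insert (hlw w hw) (hH.measurable _) (hM _), Finset.insert_union,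
    Finset.union_insert]

theorem AnchoredFamily.intervalIntegrable_sobolSum_update (hH : AnchoredFamily H) (hl : l ∈ P)
    (c x : ι → ℝ) (p q : ℝ) :
    IntervalIntegrable (fun r => sobolSum c H P (Function.update x l r)) volume p q := by
  obtain ⟨M, hM⟩ := hH.bounded
  have hsum := IntervalIntegrable.sum Pᶜ.powerset fun w hw =>
    intervalIntegrable_iteratedPrimitive_update (hH.measurable (w ∪ P)) (hM _)
      (fun h => Finset.mem_compl.1 (Finset.mem_powerset.1 hw h) hl) c x p q
  simpa only [Finset.sum_fn, sobolSum] using hsum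

theorem AnchoredFamily.sobolSum_sub_update (hH : AnchoredFamily H) (hl : l ∉ P) (c x : ι → ℝ)
    (z : ℝ) : sobolSum c H P x - sobolSum c H P (Function.update x l z) =
      ∫ r in z..x l, sobolSum c H (insert l P) (Function.update x l r) := by
  have hconst : ∀ w ∈ (insert l P)ᶜ.powerset, iteratedPrimitive c w (H (w ∪ P))
      (Function.update x l z) = iteratedPrimitive c w (H (w ∪ P)) x := fun w hw => by
    have hlw : l ∉ w := fun h => by simpa using Finset.mem_powerset.1 hw h
    refine iteratedPrimitive_update hlw (fun x r => hH.dependsOn _ fun m hm => ?_) c x z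
    refine Function.update_of_ne (ne_of_mem_of_not_mem hm fun h => ?_) _ _
    exact (Finset.mem_union.1 h).elim hlw hl
  have hintegrable := hH.intervalIntegrable_sobolSum_update (Finset.mem_insert_self l P) c x
  rw [hH.sobolSum_eq_add hl c x, hH.sobolSum_eq_add hl c (Function.update x l z),
    Finset.sum_congr rfl hconst, add_sub_add_left_eq_sub]
  simp only [Function.update_idem, Function.update_self]
  exact intervalIntegral.integral_interval_sub_left (hintegrable _ _) (hintegrable _ _)

theorem AnchoredFamily.exists_forall_abs_sobolSum_le (hH : AnchoredFamily H) {a b : ι → ℝ}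
    (hc : c ∈ Icc a b) : ∃ M, ∀ P, ∀ x ∈ Icc a b, |sobolSum c H P x| ≤ M := by
  obtain ⟨M, hM⟩ := hH.bounded
  have hM0 : 0 ≤ M := (abs_nonneg _).trans (hM ∅ c)
  have hedge : ∀ m, ∀ x ∈ Icc a b, |x m - c m| ≤ b m - a m := fun m x hx =>
    abs_sub_le_of_le_of_le (hx.1 m) (hx.2 m) (hc.1 m) (hc.2 m)
  have hterm : ∀ w : Finset ι, 0 ≤ M * ∏ m ∈ w, (b m - a m) := fun w =>
    mul_nonneg hM0 (Finset.prod_nonneg fun m _ => (abs_nonneg _).trans (hedge m c hc))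
  refine ⟨∑ w : Finset ι, M * ∏ m ∈ w, (b m - a m), fun P x hx => ?_⟩
  calc |sobolSum c H P x|
      ≤ ∑ w ∈ Pᶜ.powerset, |iteratedPrimitive c w (H (w ∪ P)) x| := Finset.abs_sum_le_sum_abs _ _
    _ ≤ ∑ w ∈ Pᶜ.powerset, M * ∏ m ∈ w, (b m - a m) := by
        gcongr with w
        refine (abs_iteratedPrimitive_le (hM _) c w x).trans ?_
        gcongr with m
        exact hedge m x hx
    _ ≤ ∑ w : Finset ι, M * ∏ m ∈ w, (b m - a m) :=
        Finset.sum_le_sum_of_subset_of_nonneg (Finset.subset_univ _) fun w _ _ => hterm w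

theorem AnchoredFamily.weakMixedFamily_sobolSum (hH : AnchoredFamily H) {a b : ι → ℝ}
    (hc : c ∈ Icc a b) : WeakMixedFamily a b fun P => (Icc a b).indicator (sobolSum c H P) where
  measurable P := (Finset.measurable_fun_sum _ fun w _ =>
    measurable_iteratedPrimitive c w (hH.measurable _)).indicator measurableSet_Icc
  bounded := by
    obtain ⟨M, hM⟩ := hH.exists_forall_abs_sobolSum_le hc
    refine ⟨M, fun P x => ?_⟩
    by_cases hx : x ∈ Icc a b
    · rw [indicator_of_mem hx]
      exact hM P x hx
    · rw [indicator_of_notMem hx, abs_zero]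
      exact (abs_nonneg _).trans (hM P c hc)
  zero P x hx := indicator_of_notMem hx _
  sub_eq P l hl x hx z hz := by
    have hxl : x l ∈ Icc (a l) (b l) := ⟨hx.1 l, hx.2 l⟩
    rw [indicator_of_mem hx, indicator_of_mem ((update_mem_Icc_iff hx).2 hz),
      hH.sobolSum_sub_update hl]
    exact intervalIntegral.integral_congr fun r hr =>
      (indicator_of_mem ((update_mem_Icc_iff hx).2 (uIcc_subset_Icc hz hxl hr)) _).symm

theorem AnchoredFamily.sobolSum_of_anchored (hH : AnchoredFamily H) (hx : ∀ l ∉ P, x l = c l) :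
    sobolSum c H P x = H P x := by
  obtain ⟨M, hM⟩ := hH.bounded
  rw [sobolSum, Finset.sum_eq_single_of_mem ∅ (Finset.empty_mem_powerset _),
    iteratedPrimitive_empty, Finset.empty_union]
  intro w hw hne
  obtain ⟨l, hl⟩ := Finset.nonempty_iff_ne_empty.2 hne
  exact iteratedPrimitive_eq_zero (hM _) hl
    (hx l (Finset.mem_compl.1 (Finset.mem_powerset.1 hw hl)))

end Sobol

section SobolExtension

variable {ι : Type*} [DecidableEq ι] {D : Set (ι → ℝ)} {c : ι → ℝ}
  {F : Finset ι → (ι → ℝ) → ℝ} {g : (ι → ℝ) → ℝ}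

theorem IsSobolExtensible.foldr_partialWithin_eq (hD : IsSobolExtensible D c)
    (hF : ∀ v, ∀ l ∉ v, ∀ x ∈ D, HasPartialWithinAt D (F v) l x (F (insert l v) x))
    (hFg : EqOn (F ∅) g D) {L : List ι} (hL : L.Nodup) {x : ι → ℝ} (hx : x ∈ D)
    (hxc : ∀ l ∈ L, x l ≠ c l) : L.foldr (partialWithin D) g x = F L.toFinset x := by
  induction L generalizing x with
  | nil => exact (hFg hx).symm
  | cons l L ih =>
    obtain ⟨hlL, hL⟩ := List.nodup_cons.1 hL
    have hunique : UniqueDiffWithinAt ℝ (slice D x l) (x l) :=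
      (uniqueDiffOn_Icc (inf_lt_sup.2 (hxc l List.mem_cons_self).symm) _ right_mem_uIcc).mono
        fun r hr => hD.update_mem hx hr
    have hmem : x l ∈ slice D x l := by simpa [slice] using hx
    rw [List.foldr_cons, List.toFinset_cons]
    refine ((hF L.toFinset l (by simpa using hlL) x hx).congr_of_mem (fun r hr => ?_)
      hmem).derivWithin hunique
    refine ih hL hr fun m hm => ?_
    rw [Function.update_of_ne (ne_of_mem_of_not_mem hm hlL)]
    exact hxc m (List.mem_cons_of_mem _ hm)

/-- The function `x ↦ 1_D(z) F_w(z)` at the hybrid point `z = c_{-w} : x_w`. -/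
noncomputable def anchoredDeriv (D : Set (ι → ℝ)) (c : ι → ℝ) (F : Finset ι → (ι → ℝ) → ℝ)
    (w : Finset ι) (x : ι → ℝ) : ℝ :=
  D.indicator (F w) (w.piecewise x c)

theorem anchoredFamily_anchoredDeriv [Finite ι] (hD : IsCompact D)
    (hF : ∀ v, ContinuousOn (F v) D) (c : ι → ℝ) : AnchoredFamily (anchoredDeriv D c F) where
  measurable w := (measurable_indicator_of_continuousOn hD.measurableSet (hF w)).comp
    (measurable_pi_iff.2 fun m => by by_cases hm : m ∈ w <;> simp [hm, measurable_pi_apply])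
  bounded := (exists_forall_abs_indicator_le hD hF).imp fun _ hM w _ => hM w _
  dependsOn w x y hxy := congrArg (D.indicator (F w)) (w.piecewise_congr hxy fun _ _ => rfl)

theorem IsSobolExtensible.sobolSum_anchoredDeriv [Fintype ι] (hD : IsSobolExtensible D c)
    (hcompact : IsCompact D) (hFc : ∀ v, ContinuousOn (F v) D)
    (hF : ∀ v, ∀ l ∉ v, ∀ x ∈ D, HasPartialWithinAt D (F v) l x (F (insert l v) x))
    (T P : Finset ι) {x : ι → ℝ} (hx : x ∈ D) (hxc : ∀ l ∉ P ∪ T, x l = c l) :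
    sobolSum c (anchoredDeriv D c F) P x = F P x := by
  have hH := anchoredFamily_anchoredDeriv hcompact hFc c
  induction T using Finset.induction_on generalizing P x with
  | empty =>
    rw [Finset.union_empty] at hxc
    have hpiecewise : P.piecewise x c = x := funext fun m => by
      by_cases hm : m ∈ P <;> simp [hm, hxc]
    rw [hH.sobolSum_of_anchored hxc, anchoredDeriv, hpiecewise, indicator_of_mem hx]
  | insert l T hl ih =>
    by_cases hlP : l ∈ P
    · exact ih P hx (by rwa [Finset.union_insert, Finset.insert_eq_of_mem (by simp [hlP])] at hxc)
    have hanchor : sobolSum c (anchoredDeriv D c F) P (Function.update x l (c l)) =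
        F P (Function.update x l (c l)) := by
      refine ih P (hD.update_mem hx left_mem_uIcc) fun m hm => ?_
      obtain rfl | hml := eq_or_ne m l
      · exact Function.update_self _ _ _
      · rw [Function.update_of_ne hml]
        exact hxc m (by simpa [hml] using hm)
    have hintegral : ∫ r in c l..x l, sobolSum c (anchoredDeriv D c F) (insert l P)
        (Function.update x l r) = ∫ r in c l..x l, F (insert l P) (Function.update x l r) :=
      intervalIntegral.integral_congr fun r hr =>
        ih (insert l P) (hD.update_mem hx hr) fun m hm => by
          have hml : m ≠ l := by rintro rfl; simp at hm
          rw [Function.update_of_ne hml]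
          exact hxc m (by simpa [hml] using hm)
    rw [← hH.sobolSum_sub_update hlP, hanchor, ← HasPartialWithinAt.sub_update_eq_integral
      (fun r hr => hD.update_mem hx hr) (hFc _) (hF P l hlP)] at hintegral
    exact sub_left_injective hintegral

variable {s d : ℕ} {D : Set (Fin s × Fin d → ℝ)} {c : Fin s × Fin d → ℝ}
  {F : Finset (Fin s × Fin d) → (Fin s × Fin d → ℝ) → ℝ} {g : (Fin s × Fin d → ℝ) → ℝ}

theorem IsSobolExtensible.mixedPartial_eq (hD : IsSobolExtensible D c)
    (hF : ∀ v, ∀ l ∉ v, ∀ x ∈ D, HasPartialWithinAt D (F v) l x (F (insert l v) x))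
    (hFg : EqOn (F ∅) g D) {w : Finset (Fin s × Fin d)} {x : Fin s × Fin d → ℝ} (hx : x ∈ D)
    (hxc : ∀ l ∈ w, x l ≠ c l) : mixedPartial D g w x = F w x := by
  obtain ⟨L, hL, rfl, hpartial⟩ := exists_mixedPartial_eq_foldr w
  rw [hpartial]
  exact hD.foldr_partialWithin_eq hF hFg hL hx fun l hl => hxc l (List.mem_toFinset.2 hl)

theorem IsSobolExtensible.sobolExtension_eq_sobolSum (hD : IsSobolExtensible D c)
    (hF : ∀ v, ∀ l ∉ v, ∀ x ∈ D, HasPartialWithinAt D (F v) l x (F (insert l v) x))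
    (hFg : EqOn (F ∅) g D) :
    sobolExtension D c g = sobolSum c (anchoredDeriv D c F) ∅ := by
  funext x
  rw [sobolExtension, sobolSum, Finset.compl_empty, Finset.powerset_univ]
  refine Finset.sum_congr rfl fun w _ =>
    congrArg (_ * ·) (integral_congr_ae (ae_restrict_of_ae ?_))
  have hne : ∀ᵐ y : w → ℝ, ∀ l : w, y l ≠ c l := ae_all_iff.2 fun l =>
    Measure.ae_eval_ne (μ := fun _ : w => (volume : Measure ℝ)) l (c l)
  filter_upwards [hne] with y hy
  have hpiecewise : w.piecewise (hybrid x w y) c = hybrid c w y := by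
    funext m
    by_cases hm : m ∈ w <;> simp [hybrid, hm]
  rw [anchoredDeriv, Finset.union_empty, hpiecewise]
  by_cases hmem : hybrid c w y ∈ D
  · rw [indicator_of_mem hmem, indicator_of_mem hmem, hD.mixedPartial_eq hF hFg hmem]
    exact fun l hl => by simpa [hybrid, hl] using hy ⟨l, hl⟩
  · rw [indicator_of_notMem hmem, indicator_of_notMem hmem]

theorem IsSobolExtensible.hasWeakMixedDerivsOn_sobolExtension (hD : IsSobolExtensible D c)
    (hcompact : IsCompact D) (hg : SmoothOn D g) :
    HasWeakMixedDerivsOn (rectHull D) (sobolExtension D c g) := by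
  obtain ⟨F, hFg, hFc, hF⟩ := hg
  have hc : c ∈ rectHull D := subset_rectHull hcompact.isBounded hD.anchor_mem
  rw [hD.sobolExtension_eq_sobolSum hF hFg]
  rw [rectHull_eq_Icc] at hc ⊢
  exact ⟨_, _, rfl, _, (anchoredFamily_anchoredDeriv hcompact hFc c).weakMixedFamily_sobolSum hc,
    fun x hx => (indicator_of_mem hx _).symm⟩

theorem IsSobolExtensible.eqOn_sobolExtension (hD : IsSobolExtensible D c)
    (hcompact : IsCompact D) (hg : SmoothOn D g) : EqOn (sobolExtension D c g) g D := by
  obtain ⟨F, hFg, hFc, hF⟩ := hg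
  intro x hx
  rw [hD.sobolExtension_eq_sobolSum hF hFg,
    hD.sobolSum_anchoredDeriv hcompact hFc hF Finset.univ ∅ hx (by simp), hFg hx]

end SobolExtension

theorem mainTheorem5_general {s d b : ℕ} (hd : 0 < d) (hb : 0 < b)
    {X : Fin s → Set (EuclideanSpace ℝ (Fin d))} (hXb : ∀ j, Bornology.IsBounded (X j))
    (hXv : ∀ j, volume (X j) = 1) (S : ∀ j, RecursiveSplit b (X j)) {C : ℝ}
    (hdiam : ∀ j k t, t < b ^ k →
      Metric.diam ((S j).cell k t) ≤ C * (b : ℝ) ^ (-((k : ℝ) / (d : ℝ))))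
    {f : (Fin s × Fin d → ℝ) → ℝ} (hf : IntegrableOn f (prodSet X)) (u : Finset (Fin s))
    (κ : u → ℕ) (τ : ∀ j : u, Fin (b ^ κ j)) (γ : u → Fin b) {e : (Fin s × Fin d → ℝ) → ℝ}
    (he : HasWeakMixedDerivsOn (rectHull (prodSet X)) e)
    (hef : EqOn e (anova X f u) (prodSet X)) :
    ENNReal.ofReal |innerProd X f (multiHaar S u κ τ γ)| ≤ coefficientBound S C u κ τ e := by
  have hinner : innerProd X e (multiHaar S u κ τ γ) =
      innerProd X (anova X f u) (multiHaar S u κ τ γ) :=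
    setIntegral_congr_fun (measurableSet_prodSet fun j => (S j).measurableSet) fun x hx => by
      rw [hef hx]
  rw [← innerProd_anova_multiHaar S u κ τ γ hXv hf, ← hinner, ← Real.enorm_eq_ofReal_abs]
  exact he.enorm_innerProd_multiHaar_le_coefficientBound S u κ τ γ hd hb hXb hXv hdiam

theorem mainTheorem5 (s d b : ℕ) (hd : 0 < d) (hb : 2 ≤ b)
    (X : Fin s → Set (EuclideanSpace ℝ (Fin d)))
    (hXb : ∀ j, Bornology.IsBounded (X j)) (hXv : ∀ j, volume (X j) = 1)
    (S : ∀ j, RecursiveSplit b (X j)) (C : ℝ) (hC : 1 ≤ C)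
    (hdiam : ∀ j k t, t < b ^ k →
      Metric.diam ((S j).cell k t) ≤ C * (b : ℝ) ^ (-((k : ℝ) / (d : ℝ))))
    (f : (Fin s × Fin d → ℝ) → ℝ) (u : Finset (Fin s)) (κ : u → ℕ)
    (τ : ∀ j : u, Fin (b ^ κ j)) (γ : u → Fin b) :
    (∀ c, IsSobolExtensible (prodSet X) c → SmoothOn (prodSet X) f →
      ENNReal.ofReal |innerProd X f (multiHaar S u κ τ γ)| ≤
        coefficientBound S C u κ τ (sobolExtension (prodSet X) c (anova X f u))) ∧
    ((∀ j, IsClosed (X j) ∧ (interior (X j)).Nonempty ∧ volume (frontier (X j)) = 0) →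
      InCm (prodSet X) (d * s) f →
      ∀ e, IsWhitneyExtension (prodSet X) (d * s) (anova X f u) e →
        ENNReal.ofReal |innerProd X f (multiHaar S u κ τ γ)| ≤
          coefficientBound S C u κ τ e) := by
  refine ⟨fun c hc hf => ?_, fun hX hf e he => ?_⟩
  · have hcompact := isCompact_prodSet hXb hc.isClosed
    have hanova := smoothOn_anova (fun j => (S j).measurableSet) hXv hcompact hc.convex_slice hf u
    exact mainTheorem5_general hd (by lia) hXb hXv S hdiam
      (hf.continuousOn.integrableOn_compact hcompact) u κ τ γ
      (hc.hasWeakMixedDerivsOn_sobolExtension hcompact hanova)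
      (hc.eqOn_sobolExtension hcompact hanova)
  · have hcompact := isCompact_prodSet hXb (isClosed_prodSet fun j => (hX j).1)
    have hcard : Fintype.card (Fin s × Fin d) ≤ d * s := by simp [mul_comm]
    exact mainTheorem5_general hd (by lia) hXb hXv S hdiam
      ((hf.smoothOn hcard).continuousOn.integrableOn_compact hcompact) u κ τ γ
      (he.hasWeakMixedDerivsOn hcard) (he.eqOn (subset_rectHull (isBounded_prodSet hXb)))
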